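/- **Setting.** Let $p\ge 1$, let $\kappa_\ell=\kappa_{\ell+1/2}>0$ be $p$-periodic diffusivities ($\ell$ modulo $p$), and consider the heterogeneous lattice diffusion $d^2\partial_t u_i=\kappa_{i}(u_{i+1}-u_i)+\kappa_{i-1}(u_{i-1}-u_i)$ with lattice spacing $d$. Its homogenisation is the equation $$\partial_t V=K_2\,\partial_x^2V+K_4d^2\,\partial_x^4V+K_6d^4\,\partial_x^6V+\cdots ,$$ where $g(s)=\sum_{m\ge1} K_ms^m\in\mathbb R[[s]]$ is the slow branch, in powers of $s=\mathrm ik$ ($k$ the scaled wavenumber), of the Fourier transformed ensemble of phase shifts: $g(0)=0$, and there are $\chi_\ell\in\mathbb R[[s]]$, $\ell\in\mathbb Z/p$, with $\frac1p\sum_\ell\chi_\ell=1$ and $$g\chi_\ell=\kappa_\ell(e^{s}\chi_{\ell+1}-\chi_\ell)+\kappa_{\ell-1}(e^{-s}\chi_{\ell-1}-\chi_\ell).$$ The patch scheme on a macroscale-periodic domain of length $L>0$ has $N$ patches of $n\ge 1$ interior points each, patch spacing $H=L/N$, and ratio $r=nd/H\le 1$. Its unknowns are $u^I_i(t)$, $N$-periodic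 in the patch index $I$, with $i=0,\dots,n+1$; they satisfy $$d^2\partial_tu^I_i=\kappa_i(u^I_{i+1}-u^I_i)+\kappa_{i-1}(u^I_{i-1}-u^I_i)\quad(1\le i\le n),\qquad u^I_{n+1}=E^{r}u^I_1,\qquad u^I_0=E^{-r}u^I_n,$$ where the fractional macroscale shift $E^{\pm r}$ in $I$ is realised either by spectral interpolation, $E^{r}f^I=\sum_{J=1}^{N} f^J\,\frac1N\,\mathrm{Re}\sum_{-N/2<j\le N/2}e^{2\pi \mathrm ij(I-J+r)/N}$, or by Lagrangian interpolation of order $P\ge1$, $$E^{r}f=f+\sum_{k=1}^P\Big(\prod_{\ell=0}^{k-1}(r^2-\ell^2)\Big)\frac{(2k/r)\mu\delta^{2k-1}+\delta^{2k}}{(2k)!}f,$$ with $\delta^2f^I=f^{I+1}-2f^I+f^{I-1}$ and $\mu\delta f^I=\frac12(f^{I+1}-f^{I-1})$. Point $i$ of patch $I$ lies at $x^I_i=IH+id$. The patch scheme for the ensemble of all phase shifts is $$d^2\partial_tv^I_{i,\ell}=\kappa_\ell(v^I_{i+1,\ell+1}-v^I_{i,\ell})+\kappa_{\ell-1}(v^I_{i-1,\ell-1}-v^I_{i,\ell}),\qquad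 v^I_{n+1,\ell}=E^rv^I_{1,\ell},\qquad v^I_{0,\ell}=E^{-r}v^I_{n,\ell}.$$ The patch scheme (without the ensemble) is called *consistent with the homogenisation to order $H^{2M}$* if for every choice of weights $\omega_1,\dots,\omega_n\in\mathbb R$ with $\sum_i\omega_i=1$ (defining the macroscale patch value $\sum_i\omega_iu^I_i$, attributed to the patch centre $X^I=IH+\frac{n+1}2d$) and every real $L$-periodic trigonometric polynomial $V_0$ of degree at most $B$, there are $C$ and $N_0$ such that, for all $N\ge N_0$ and all $d>0$ with $nd\le H=L/N$, there are a solution $u$ of the patch scheme and a field $V(x,t)$, for each $t$ an $L$-periodic trigonometric polynomial in $x$ of degree at most $B$, with $V(\cdot,0)=V_0$ and, for all $t\ge0$: $\sum_i\omega_iu^I_i(t)=V(X^I,t)$ for all $I$; $|u^I_i(t)-V(x^I_i,t)|\le CH$ for all $I$ and $1\le i\le n$; and $$\Big|\partial_tV-\sum_{m=1}^MK_{2m}d^{2m-2}\partial_x^{2m}V\Big|\le C H^{2M}\quad\text{for all }x.$$ **Statement.** Suppose $p$ divides $n$. 1. The inter-patch coupling of the ensemble never mixes phases: for either coupling, $v$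 solves the ensemble patch scheme if and only if, for every phase $\varphi\in\mathbb Z/p$, $u^I_i:=v^I_{i,i+\varphi}$ solves the patch scheme applied directly to the heterogeneous diffusion with the shifted diffusivities $\kappa_{\cdot+\varphi}$. 2. The homogenisation is well defined: $g$ exists and is unique, its odd coefficients vanish, and $K_2=p\big/\sum_{\ell}\kappa_\ell^{-1}$. 3. The patch scheme applied directly to the heterogeneous diffusion, without the ensemble, is consistent with this homogenisation to arbitrarily high order in $H$: with spectral coupling, to order $H^{2M}$ for every $M\ge1$; with Lagrangian coupling of order $P$, to order $H^{2M}$ for every $1\le M\le P$. -/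

import Mathlib

namespace PatchScheme

/-! Throughout, `κ : ZMod p → ℝ` lists the `p`-periodic diffusivities, `κ ℓ` standing for the
diffusivity between the lattice points `ℓ` and `ℓ + 1`. Patches are indexed by `I : ℤ`, with all
fields `N`-periodic in `I`, and the points of a patch by `i = 0, …, n + 1`. -/

/-- The inter-patch couplings: global spectral interpolation, and Lagrangian interpolation from the
`P` nearest neighbouring patches on either side. -/
inductive Coupling : Type
  | spectral : Coupling
  | lagrangian (P : ℕ) : Coupling

/-- The operator `μδ` on macroscale sequences. -/
noncomputable def meanDiff (f : ℤ → ℝ) : ℤ → ℝ :=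
  fun I => (f (I + 1) - f (I - 1)) / 2

/-- The operator `δ²` on macroscale sequences. -/
def diffSq (f : ℤ → ℝ) : ℤ → ℝ :=
  fun I => f (I + 1) - 2 * f I + f (I - 1)

/-- The order `P` expansion in `μδ` and `δ²` of the fractional macroscale shift `E ^ r`. -/
noncomputable def lagrangianShift (P : ℕ) (r : ℝ) (f : ℤ → ℝ) (I : ℤ) : ℝ :=
  f I + ∑ k ∈ Finset.Icc 1 P, (∏ l ∈ Finset.range k, (r ^ 2 - (l : ℝ) ^ 2)) *
    ((2 * k / r) * meanDiff (diffSq^[k - 1] f) I + diffSq^[k] f I) / ((2 * k).factorial : ℝ)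

/-- The spectral interpolation coefficient `(1/N) ∑ₖ exp (i k H (m + r))` for the wavenumbers
`k = 2πj/(N H)` with `-N/2 < j ≤ N/2`. The sum is real when `N` is odd. When `N` is even, taking the
real part is the usual symmetrisation of the unpaired wavenumber `j = N/2`. -/
noncomputable def spectralWeight (N : ℕ) (r : ℝ) (m : ℤ) : ℝ :=
  (1 / (N : ℝ)) * ∑ j ∈ Finset.Ioc ((-(N : ℤ)) / 2) ((N : ℤ) / 2),
    (Complex.exp (Complex.I * (2 * Real.pi * (j : ℝ) * ((m : ℝ) + r) / (N : ℝ) : ℝ))).re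

/-- Shift by the fraction `r` of the patch spacing through the discrete Fourier transform of the
`N` values of an `N`-periodic sequence. -/
noncomputable def spectralShift (N : ℕ) (r : ℝ) (f : ℤ → ℝ) (I : ℤ) : ℝ :=
  ∑ J ∈ Finset.range N, spectralWeight N r (I - (J : ℤ)) * f (J : ℤ)

/-- The realisation of the fractional macroscale shift `E ^ r` by each of the couplings. -/
noncomputable def Coupling.shift : Coupling → ℕ → ℝ → (ℤ → ℝ) → ℤ → ℝ
  | .spectral, N, r, f, I => spectralShift N r f I
  | .lagrangian P, _, r, f, I => lagrangianShift P r f I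

/-- The patch spacing `H`, for `N` patches on a domain of length `L`. -/
noncomputable def spacing (L : ℝ) (N : ℕ) : ℝ := L / N

/-- The ratio `r = h / H` of the patch width `h = n d` to the patch spacing. -/
noncomputable def ratio (L : ℝ) (N n : ℕ) (d : ℝ) : ℝ := (n * d) / spacing L N

/-- The location of point `i` of patch `I`, also for real `i`: the centre is `i = (n + 1) / 2`. -/
noncomputable def location (L : ℝ) (N : ℕ) (d : ℝ) (I : ℤ) (i : ℝ) : ℝ :=
  I * spacing L N + i * d

/-- `u t I i` solves the patch scheme applied directly to the heterogeneous diffusion with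
diffusivities `κ`: `N` patches of size `n` on a macroscale periodic domain of length `L`, with
lattice spacing `d`. -/
structure IsPatchSolution {p : ℕ} (c : Coupling) (L : ℝ) (N n : ℕ) (d : ℝ) (κ : ZMod p → ℝ)
    (u : ℝ → ℤ → ℤ → ℝ) : Prop where
  periodic : ∀ t I i, u t (I + N) i = u t I i
  right_edge : ∀ t I, u t I (n + 1) = c.shift N (ratio L N n d) (fun J => u t J 1) I
  left_edge : ∀ t I, u t I 0 = c.shift N (-ratio L N n d) (fun J => u t J n) I
  ode : ∀ t I, ∀ i ∈ Finset.Icc (1 : ℤ) n,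
    HasDerivAt (fun s => u s I i)
      ((κ (i : ZMod p) * (u t I (i + 1) - u t I i)
        + κ ((i - 1 : ℤ) : ZMod p) * (u t I (i - 1) - u t I i)) / d ^ 2) t

/-- `v t I i ℓ` solves the patch scheme applied to the ensemble of all `p` phase shifts of the
heterogeneous diffusion, in the arrangement where the diffusivity only depends on the
cross-sectional index `ℓ`, and where the patches are coupled at equal `ℓ`. The member of phase `φ`
is `v t I i (i + φ)`. -/
structure IsEnsemblePatchSolution {p : ℕ} (c : Coupling) (L : ℝ) (N n : ℕ) (d : ℝ)
    (κ : ZMod p → ℝ) (v : ℝ → ℤ → ℤ → ZMod p → ℝ) : Prop where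
  periodic : ∀ t I i ℓ, v t (I + N) i ℓ = v t I i ℓ
  right_edge : ∀ t I ℓ, v t I (n + 1) ℓ = c.shift N (ratio L N n d) (fun J => v t J 1 ℓ) I
  left_edge : ∀ t I ℓ, v t I 0 ℓ = c.shift N (-ratio L N n d) (fun J => v t J n ℓ) I
  ode : ∀ t I, ∀ i ∈ Finset.Icc (1 : ℤ) n, ∀ ℓ,
    HasDerivAt (fun s => v s I i ℓ)
      ((κ ℓ * (v t I (i + 1) (ℓ + 1) - v t I i ℓ)
        + κ (ℓ - 1) * (v t I (i - 1) (ℓ - 1) - v t I i ℓ)) / d ^ 2) t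

/-- `g` is the symbol of the homogenised equation
`∂ₜV = ∑ₘ Kₘ d ^ (m - 2) ∂ₓ ^ m V`, `Kₘ = coeff m g`: the slow branch, as a power series in
`X = i k` for the scaled wavenumber `k`, of the lattice equations of the ensemble, which in Fourier
space read
`d² ∂ₜ χ_ℓ = κ_ℓ (exp (i k) χ_{ℓ+1} - χ_ℓ) + κ_{ℓ-1} (exp (-i k) χ_{ℓ-1} - χ_ℓ)`.
The slow branch is parametrised by the mean of `χ` over `ℓ`, and is at equilibrium for `k = 0`. -/
def IsHomogenisedSymbol {p : ℕ} [NeZero p] (κ : ZMod p → ℝ) (g : PowerSeries ℝ) : Prop :=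
  PowerSeries.constantCoeff g = 0 ∧
  ∃ χ : ZMod p → PowerSeries ℝ,
    (∑ ℓ, χ ℓ = PowerSeries.C (p : ℝ)) ∧
    ∀ ℓ, g * χ ℓ =
      PowerSeries.C (κ ℓ) * (PowerSeries.exp ℝ * χ (ℓ + 1) - χ ℓ)
      + PowerSeries.C (κ (ℓ - 1)) *
          (PowerSeries.evalNegHom (PowerSeries.exp ℝ) * χ (ℓ - 1) - χ ℓ)

/-- The `L`-periodic, band-limited macroscale field with Fourier coefficients `a`, `b`. -/
noncomputable def trigField (L : ℝ) (B : ℕ) (a b : ℕ → ℝ) (x : ℝ) : ℝ :=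
  ∑ j ∈ Finset.range (B + 1),
    (a j * Real.cos (2 * Real.pi * j * x / L) + b j * Real.sin (2 * Real.pi * j * x / L))

/-- The right-hand side `∑_{m=1}^{M} K_{2m} d^{2m-2} ∂ₓ^{2m} V` of the homogenised equation. -/
noncomputable def homogenisedRHS (g : PowerSeries ℝ) (d : ℝ) (M : ℕ) (V : ℝ → ℝ) (x : ℝ) : ℝ :=
  ∑ m ∈ Finset.Icc 1 M,
    PowerSeries.coeff (2 * m) g * d ^ (2 * m - 2) * iteratedDeriv (2 * m) V x

/-- Consistency, with error of order `H ^ (2M)`, of the macroscale of the patch scheme with the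
homogenised equation of symbol `g`. The macroscale value of a patch is any fixed average with
weights `ω` of its interior values (a mid-patch value, the patch mean, …), attributed to the centre
of the patch. From every band-limited macroscale field starts a solution of the patch scheme whose
macroscale values are those of a field `V` of the same band, such that the microscale field is `V`
up to `O(H)`, and `V` satisfies the homogenised equation up to `O(H ^ (2M))`, uniformly in time,
in the lattice spacing `d` and in the number of patches. -/
def ConsistentToOrder {p : ℕ} (c : Coupling) (L : ℝ) (n : ℕ) (κ : ZMod p → ℝ)
    (g : PowerSeries ℝ) (M : ℕ) : Prop :=
  ∀ ω : ℤ → ℝ, ∑ i ∈ Finset.Icc (1 : ℤ) n, ω i = 1 →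
  ∀ (B : ℕ) (a₀ b₀ : ℕ → ℝ),
  ∃ (C : ℝ) (N₀ : ℕ), ∀ N : ℕ, N₀ ≤ N → ∀ d : ℝ, 0 < d → n * d ≤ spacing L N →
  ∃ (u : ℝ → ℤ → ℤ → ℝ) (a b : ℝ → ℕ → ℝ),
    IsPatchSolution c L N n d κ u ∧ a 0 = a₀ ∧ b 0 = b₀ ∧
    ∀ t : ℝ, 0 ≤ t →
      (∀ I : ℤ, ∑ i ∈ Finset.Icc (1 : ℤ) n, ω i * u t I i
        = trigField L B (a t) (b t) (location L N d I (((n : ℝ) + 1) / 2))) ∧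
      (∀ I : ℤ, ∀ i ∈ Finset.Icc (1 : ℤ) n,
        |u t I i - trigField L B (a t) (b t) (location L N d I i)| ≤ C * spacing L N) ∧
      (∀ x : ℝ, DifferentiableAt ℝ (fun s => trigField L B (a s) (b s) x) t ∧
        |deriv (fun s => trigField L B (a s) (b s) x) t
            - homogenisedRHS g d M (trigField L B (a t) (b t)) x|
          ≤ C * spacing L N ^ (2 * M))

end PatchScheme

/-! A lattice profile with growth rate `lam` is determined by one value and one flux, so the lattice
equations are a march by 2×2 matrices of determinant 1. Across `n` points with `p ∣ n`, a Bloch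
multiplier `exp (n s)` of the transfer matrix is tied to the growth rate through the trace alone:
τ(lam) = exp(ns) + exp(-ns), see `IsHomogenisedSymbol.marchTrace_aeval`. Here τ is a polynomial with
τ(0) = 2 and τ'(0) = n Σρ > 0, where ρ = 1/κ is summed over the `n` points. Hence, taking n = p, the
slow branch g is the unique power series with g(0) = 0 solving this equation (`exists_aeval_eq`,
`eq_of_aeval_eq`, `isHomogenisedSymbol_of_aeval`). It is even because the right side is even, and K₂
comes from comparing the coefficients of s².

The ensemble claim is bookkeeping: crossing a patch moves the phase index by n, which is 0 modulo p.

For consistency, a coupling acts on macroscale waves of wavenumber θ as multiplication by a symbol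
a, and the opposite shift by its conjugate. Eliminating the edge values turns the patch scheme into
τ(lam) + (|a|² - 1)(D - κ₀B) = 2 Re a, where B and D are the second column of the transfer matrix.
Since rθ = nx for the lattice wavenumber x = kd, the exact shift a = exp(irθ) would return the
homogenised equation. The spectral symbol is exact on resolved wavenumbers. The Lagrangian one obeys
the differential equation of exp(irθ) up to a small defect, so Re a - cos(rθ) and |a|² - 1 are
O((rθ)² θ^(2P)) (`symbolBound_lagrangian`). As τ is strictly increasing near 0, the patch scheme has
a rate within O(x² θ^(2M)) of the truncated symbol (`exists_mode`). With θ = kH, division by d²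
leaves O(k² (kH)^(2M)), uniformly in d. Finitely many such modes with nonpositive rates are
superposed. -/

namespace PatchScheme

/-! ### Transfer matrices of the lattice equations -/

section March
variable {R : Type*} [CommRing R]

/-- The march through the lattice equations
`lam y_i = κ_i (y_{i+1} - y_i) + κ_{i-1} (y_{i-1} - y_i)`
with resistances `ρ = κ⁻¹`: after `i` steps the state is `(y_{i+1}, κ_i (y_{i+1} - y_i))`. -/
def march (ρ : ℕ → R) (lam : R) (v : R × R) : ℕ → R × R
  | 0 => v
  | i + 1 =>
    ((march ρ lam v i).1 + ρ (i + 1) * ((march ρ lam v i).2 + lam * (march ρ lam v i).1),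
      (march ρ lam v i).2 + lam * (march ρ lam v i).1)

variable (ρ : ℕ → R) (lam : R)

@[simp] lemma march_zero (v : R × R) : march ρ lam v 0 = v := rfl

lemma march_succ_snd (v : R × R) (i : ℕ) :
    (march ρ lam v (i + 1)).2 = (march ρ lam v i).2 + lam * (march ρ lam v i).1 := rfl

lemma march_succ_fst (v : R × R) (i : ℕ) :
    (march ρ lam v (i + 1)).1 = (march ρ lam v i).1 + ρ (i + 1) * (march ρ lam v (i + 1)).2 := rfl

lemma march_smul (c : R) (v : R × R) (i : ℕ) :
    march ρ lam (c • v) i = c • march ρ lam v i := by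
  induction i with
  | zero => rfl
  | succ i ih =>
    ext
    · simp only [march_succ_fst, march_succ_snd, ih, Prod.smul_fst, Prod.smul_snd, smul_eq_mul]
      ring
    · simp only [march_succ_snd, ih, Prod.smul_fst, Prod.smul_snd, smul_eq_mul]
      ring

lemma march_eq_add (v : R × R) (i : ℕ) :
    (march ρ lam v i).1 = (march ρ lam (1, 0) i).1 * v.1 + (march ρ lam (0, 1) i).1 * v.2 ∧
    (march ρ lam v i).2 = (march ρ lam (1, 0) i).2 * v.1 + (march ρ lam (0, 1) i).2 * v.2 := by
  induction i with
  | zero => simp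
  | succ i ih =>
    obtain ⟨h1, h2⟩ := ih
    simp only [march_succ_fst, march_succ_snd]
    rw [h1, h2]
    constructor <;> ring

lemma march_snd (v : R × R) (i : ℕ) :
    (march ρ lam v i).2 = (march ρ lam (1, 0) i).2 * v.1 + (march ρ lam (0, 1) i).2 * v.2 :=
  (march_eq_add ρ lam v i).2

/-- Each step of the march is a product of two shears, one in the flux and one in the value. -/
lemma march_det (i : ℕ) :
    (march ρ lam (1, 0) i).1 * (march ρ lam (0, 1) i).2
      - (march ρ lam (0, 1) i).1 * (march ρ lam (1, 0) i).2 = 1 := by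
  induction i with
  | zero => simp
  | succ i ih =>
    simp only [march_succ_fst, march_succ_snd]
    linear_combination ih

lemma march_map {S : Type*} [CommRing S] (φ : R →+* S) (v : R × R) (i : ℕ) :
    march (fun j => φ (ρ j)) (φ lam) (φ v.1, φ v.2) i
      = (φ (march ρ lam v i).1, φ (march ρ lam v i).2) := by
  induction i with
  | zero => rfl
  | succ i ih =>
    ext
    · simp only [march_succ_fst, march_succ_snd, ih, map_add, map_mul]
    · simp only [march_succ_snd, ih, map_add, map_mul]

/-- At equilibrium the flux is constant, and the value grows by flux times accumulated resistance.
-/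
lemma march_at_zero (v : R × R) (i : ℕ) :
    march ρ 0 v i = (v.1 + (∑ j ∈ Finset.range i, ρ (j + 1)) * v.2, v.2) := by
  induction i with
  | zero => simp
  | succ i ih =>
    ext
    · simp only [march_succ_fst, march_succ_snd, ih, Finset.sum_range_succ]
      ring
    · simp only [march_succ_snd, ih]
      ring

lemma march_add (v : R × R) (m i : ℕ) (hρ : ∀ j, ρ (j + m) = ρ j) :
    march ρ lam v (i + m) = march ρ lam (march ρ lam v m) i := by
  induction i with
  | zero => simp
  | succ i ih =>
    have h := hρ (i + 1)
    rw [show i + 1 + m = (i + m) + 1 by ring] at h ⊢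
    ext
    · simp only [march_succ_fst, march_succ_snd, ih, h]
    · simp only [march_succ_snd, ih]

/-- A solution of the lattice equations is a march. -/
lemma eq_march (κ y : ℕ → R) (hρ : ∀ i, ρ i * κ i = 1)
    (h : ∀ i, lam * y (i + 1)
      = κ (i + 1) * (y (i + 2) - y (i + 1)) + κ i * (y i - y (i + 1))) (i : ℕ) :
    march ρ lam (y 1, κ 0 * (y 1 - y 0)) i = (y (i + 1), κ i * (y (i + 1) - y i)) := by
  induction i with
  | zero => rfl
  | succ i ih =>
    have h2 : (march ρ lam (y 1, κ 0 * (y 1 - y 0)) (i + 1)).2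
        = κ (i + 1) * (y (i + 2) - y (i + 1)) := by
      rw [march_succ_snd, ih]
      linear_combination h i
    ext
    · rw [march_succ_fst, h2, ih]
      linear_combination (y (i + 2) - y (i + 1)) * hρ (i + 1)
    · exact h2

/-- A march solves the lattice equations. -/
lemma march_lattice (κ : ℕ → R) (hρ : ∀ i, κ i * ρ i = 1) (v : R × R) (i : ℕ) :
    lam * (march ρ lam v (i + 1)).1
      = κ (i + 2) * ((march ρ lam v (i + 2)).1 - (march ρ lam v (i + 1)).1)
        + κ (i + 1) * ((march ρ lam v i).1 - (march ρ lam v (i + 1)).1) := by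
  rw [march_succ_fst ρ lam v (i + 1), march_succ_snd ρ lam v (i + 1), march_succ_fst ρ lam v i]
  linear_combination (-(march ρ lam v (i + 1)).2 - lam * ((march ρ lam v i).1
    + ρ (i + 1) * (march ρ lam v (i + 1)).2)) * hρ (i + 2)
    + (march ρ lam v (i + 1)).2 * hρ (i + 1)

end March

/-! ### The transfer matrix as a polynomial in the growth rate -/

open Polynomial in
/-- The entries of the transfer matrix as polynomials in the growth rate. -/
noncomputable def marchPoly (ρ : ℕ → ℝ) (v : ℝ × ℝ) (i : ℕ) : ℝ[X] × ℝ[X] :=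
  march (fun j => C (ρ j)) X (C v.1, C v.2) i

/-- The trace of the transfer matrix across `n` points, as a polynomial in the growth rate. -/
noncomputable def marchTrace (ρ : ℕ → ℝ) (n : ℕ) : Polynomial ℝ :=
  (marchPoly ρ (1, 0) n).1 + (marchPoly ρ (0, 1) n).2

lemma march_aeval {A : Type*} [CommRing A] [Algebra ℝ A] (ρ : ℕ → ℝ) (lam : A) (v : ℝ × ℝ)
    (i : ℕ) :
    march (fun j => algebraMap ℝ A (ρ j)) lam (algebraMap ℝ A v.1, algebraMap ℝ A v.2) i
      = (Polynomial.aeval lam (marchPoly ρ v i).1, Polynomial.aeval lam (marchPoly ρ v i).2) := by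
  have := march_map (fun j => Polynomial.C (ρ j)) Polynomial.X
    (Polynomial.aeval lam : Polynomial ℝ →ₐ[ℝ] A).toRingHom (Polynomial.C v.1, Polynomial.C v.2) i
  simpa [marchPoly] using this

lemma march_aeval_left {A : Type*} [CommRing A] [Algebra ℝ A] (ρ : ℕ → ℝ) (lam : A) (i : ℕ) :
    march (fun j => algebraMap ℝ A (ρ j)) lam (1, 0) i
      = (Polynomial.aeval lam (marchPoly ρ (1, 0) i).1,
        Polynomial.aeval lam (marchPoly ρ (1, 0) i).2) := by
  simpa using march_aeval ρ lam (1, 0) i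

lemma march_aeval_right {A : Type*} [CommRing A] [Algebra ℝ A] (ρ : ℕ → ℝ) (lam : A) (i : ℕ) :
    march (fun j => algebraMap ℝ A (ρ j)) lam (0, 1) i
      = (Polynomial.aeval lam (marchPoly ρ (0, 1) i).1,
        Polynomial.aeval lam (marchPoly ρ (0, 1) i).2) := by
  simpa using march_aeval ρ lam (0, 1) i

/-- The jet of the transfer matrix at growth rate 0. The last entry makes 0 a simple zero of the
trace minus 2, on which both the formal inversion and the real root finding rest; the other entries
serve its induction and the estimates of the modes. -/
lemma marchPoly_coeff (ρ : ℕ → ℝ) (i : ℕ) :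
    (marchPoly ρ (1, 0) i).1.coeff 0 = 1 ∧
    (marchPoly ρ (0, 1) i).1.coeff 0 = ∑ j ∈ Finset.range i, ρ (j + 1) ∧
    (marchPoly ρ (1, 0) i).2.coeff 0 = 0 ∧
    (marchPoly ρ (0, 1) i).2.coeff 0 = 1 ∧
    (marchPoly ρ (1, 0) i).2.coeff 1 = i ∧
    (marchTrace ρ i).coeff 1 = i * ∑ j ∈ Finset.range i, ρ (j + 1) := by
  simp only [marchTrace, Polynomial.coeff_add]
  unfold marchPoly
  induction i with
  | zero => simp [Polynomial.coeff_one]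
  | succ i ih =>
    obtain ⟨h1, h2, h3, h4, h5, h6⟩ := ih
    simp only [march_succ_fst, march_succ_snd, Finset.sum_range_succ, Polynomial.coeff_add,
      Polynomial.coeff_C_mul, Polynomial.coeff_X_mul, Polynomial.mul_coeff_zero,
      Polynomial.coeff_X_zero, Polynomial.coeff_C_zero, zero_mul, add_zero,
      h1, h2, h3, h4, h5, Nat.cast_add, Nat.cast_one]
    refine ⟨by ring, by ring, trivial, trivial, trivial, ?_⟩
    linear_combination h6

/-! ### The slow branch as a formal power series -/

section Symbol
open PowerSeries

/-- The resistances of the lattice, listed along the naturals. -/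
noncomputable def resistance {p : ℕ} (κ : ZMod p → ℝ) (i : ℕ) : ℝ := (κ (i : ZMod p))⁻¹

/-- The formal phase shift `exp (-s)`. -/
noncomputable def expNeg : PowerSeries ℝ := evalNegHom (PowerSeries.exp ℝ)

lemma exp_mul_expNeg : PowerSeries.exp ℝ * expNeg = 1 := exp_mul_exp_neg_eq_one

lemma exp_pow_mul_expNeg_pow (n : ℕ) : PowerSeries.exp ℝ ^ n * expNeg ^ n = 1 := by
  rw [← mul_pow, exp_mul_expNeg, one_pow]

lemma expNeg_pow_eq (n : ℕ) : expNeg ^ n = evalNegHom (rescale (n : ℝ) (PowerSeries.exp ℝ)) := by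
  rw [expNeg, ← map_pow, exp_pow_eq_rescale_exp]

lemma coeff_exp_pow (n k : ℕ) :
    coeff k (PowerSeries.exp ℝ ^ n) = (n : ℝ) ^ k / k.factorial := by
  rw [exp_pow_eq_rescale_exp, coeff_rescale, coeff_exp]
  simp [div_eq_mul_inv]

lemma coeff_expNeg_pow (n k : ℕ) :
    coeff k (expNeg ^ n) = (-n : ℝ) ^ k / k.factorial := by
  rw [expNeg_pow_eq, evalNegHom, coeff_rescale, coeff_rescale, coeff_exp, neg_pow (n : ℝ)]
  simp [div_eq_mul_inv, mul_assoc]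

/-- By Cayley–Hamilton, a matrix of determinant 1 with eigenvalue `a` and inverse eigenvalue `b`
satisfies `(a + b - trace) v = 0`. In a domain one nonzero component of `v` suffices to cancel. -/
lemma marchTrace_aeval_of_eigenvector {A : Type*} [CommRing A] [IsDomain A] [Algebra ℝ A]
    (ρ : ℕ → ℝ) (lam a b : A) (v : A × A) (hv : v ≠ 0) (n : ℕ) (hab : a * b = 1)
    (h : march (fun j => algebraMap ℝ A (ρ j)) lam v n = a • v) :
    Polynomial.aeval lam (marchTrace ρ n) = a + b := by
  set ρ' : ℕ → A := fun j => algebraMap ℝ A (ρ j) with hρ'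
  have hdet := march_det ρ' lam n
  have h1 := (march_eq_add ρ' lam v n).1
  have h2 := march_snd ρ' lam v n
  rw [h] at h1 h2
  rw [marchTrace, map_add]
  have hl := march_aeval_left ρ lam n
  have hr := march_aeval_right ρ lam n
  rw [← hρ'] at hl hr
  rw [show Polynomial.aeval lam (marchPoly ρ (1, 0) n).1 = (march ρ' lam (1, 0) n).1 by rw [hl],
    show Polynomial.aeval lam (marchPoly ρ (0, 1) n).2 = (march ρ' lam (0, 1) n).2 by rw [hr]]
  generalize (march ρ' lam (1, 0) n).1 = A₁ at *
  generalize (march ρ' lam (0, 1) n).1 = B₁ at *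
  generalize (march ρ' lam (1, 0) n).2 = C₁ at *
  generalize (march ρ' lam (0, 1) n).2 = D₁ at *
  simp only [Prod.smul_fst, Prod.smul_snd, smul_eq_mul] at h1 h2
  have e1 : (a + b - (A₁ + D₁)) * v.1 = 0 := by
    linear_combination b * (a - D₁) * h1 + b * B₁ * h2 - b * v.1 * hdet
      - (a - (A₁ + D₁)) * v.1 * hab
  have e2 : (a + b - (A₁ + D₁)) * v.2 = 0 := by
    linear_combination b * (a - A₁) * h2 + b * C₁ * h1 - b * v.2 * hdet
      - (a - (A₁ + D₁)) * v.2 * hab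
  by_contra hne
  have hne' : a + b - (A₁ + D₁) ≠ 0 := fun hh => hne (sub_eq_zero.1 hh).symm
  exact hv (Prod.ext ((mul_eq_zero.1 e1).resolve_left hne') ((mul_eq_zero.1 e2).resolve_left hne'))

variable {p : ℕ}

lemma resistance_pos {κ : ZMod p → ℝ} (hκ : ∀ ℓ, 0 < κ ℓ) (i : ℕ) : 0 < resistance κ i :=
  inv_pos.2 (hκ _)

lemma sum_resistance_pos {κ : ZMod p → ℝ} (hκ : ∀ ℓ, 0 < κ ℓ) {n : ℕ} (hn : 1 ≤ n) :
    0 < ∑ j ∈ Finset.range n, resistance κ (j + 1) :=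
  Finset.sum_pos (fun _ _ => resistance_pos hκ _) (Finset.nonempty_range_iff.2 (by omega))

lemma marchTrace_coeff_one_pos {κ : ZMod p → ℝ} (hκ : ∀ ℓ, 0 < κ ℓ) {n : ℕ} (hn : 1 ≤ n) :
    0 < (marchTrace (resistance κ) n).coeff 1 := by
  rw [(marchPoly_coeff _ n).2.2.2.2.2]
  exact mul_pos (by exact_mod_cast hn) (sum_resistance_pos hκ hn)

lemma marchTrace_coeff_zero (ρ : ℕ → ℝ) (n : ℕ) : (marchTrace ρ n).coeff 0 = 2 := by
  rw [marchTrace, Polynomial.coeff_add, (marchPoly_coeff ρ n).1, (marchPoly_coeff ρ n).2.2.2.1]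
  norm_num

variable [NeZero p]

lemma sum_zmod_eq (f : ZMod p → ℝ) :
    ∑ j ∈ Finset.range p, f ((j + 1 : ℕ) : ZMod p) = ∑ ℓ, f ℓ := by
  rw [← Equiv.sum_comp (Equiv.addRight (1 : ZMod p)) f]
  refine Finset.sum_bij' (fun j _ => (j : ZMod p)) (fun ℓ _ => ℓ.val) ?_ ?_ ?_ ?_ ?_
  · simp
  · intro ℓ _
    exact Finset.mem_range.2 (ZMod.val_lt ℓ)
  · intro j hj
    exact ZMod.val_cast_of_lt (Finset.mem_range.1 hj)
  · intro ℓ _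
    exact ZMod.natCast_zmod_val ℓ
  · intro j _
    simp

/-- The characteristic equation of the slow branch across any number of periods. -/
lemma IsHomogenisedSymbol.marchTrace_aeval {κ : ZMod p → ℝ} (hκ : ∀ ℓ, 0 < κ ℓ)
    {g : PowerSeries ℝ} (hg : IsHomogenisedSymbol κ g) {n : ℕ} (hpn : p ∣ n) :
    Polynomial.aeval g (marchTrace (resistance κ) n) = PowerSeries.exp ℝ ^ n + expNeg ^ n := by
  obtain ⟨-, χ, hsum, hχ⟩ := hg
  set e := PowerSeries.exp ℝ
  have hee : e * expNeg = 1 := exp_mul_expNeg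
  -- Absorbing the phase factors into the field turns the equations of the ensemble into the plain
  -- lattice equations, with multiplier `e ^ n` across `n` points because `p ∣ n`.
  set y : ℕ → PowerSeries ℝ := fun i => e ^ i * χ (i : ZMod p) with hy
  have hρ : ∀ i : ℕ, algebraMap ℝ (PowerSeries ℝ) (resistance κ i) * C (κ (i : ZMod p)) = 1 := by
    intro i
    rw [show algebraMap ℝ (PowerSeries ℝ) = C from rfl, ← map_mul, resistance,
      inv_mul_cancel₀ (hκ _).ne', map_one]
  have hm := eq_march (fun i => algebraMap ℝ (PowerSeries ℝ) (resistance κ i)) g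
    (fun i => C (κ (i : ZMod p))) y hρ (by
      intro i
      have h := hχ ((i + 1 : ℕ) : ZMod p)
      rw [show ((i + 1 : ℕ) : ZMod p) - 1 = (i : ZMod p) by push_cast; ring,
        show ((i + 1 : ℕ) : ZMod p) + 1 = ((i + 2 : ℕ) : ZMod p) by push_cast; ring] at h
      change g * χ ((i + 1 : ℕ) : ZMod p) = C (κ ((i + 1 : ℕ) : ZMod p)) *
        (e * χ ((i + 2 : ℕ) : ZMod p) - χ ((i + 1 : ℕ) : ZMod p))
        + C (κ (i : ZMod p)) * (expNeg * χ (i : ZMod p) - χ ((i + 1 : ℕ) : ZMod p)) at h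
      simp only [hy]
      linear_combination e ^ (i + 1) * h + C (κ (i : ZMod p)) * e ^ i * χ (i : ZMod p) * hee)
  apply marchTrace_aeval_of_eigenvector (resistance κ) g (e ^ n) (expNeg ^ n)
    (y 1, C (κ ((0 : ℕ) : ZMod p)) * (y 1 - y 0)) ?_ n (exp_pow_mul_expNeg_pow n)
  · rw [hm n]
    have h0 : ((n : ℕ) : ZMod p) = 0 := (ZMod.natCast_eq_zero_iff n p).2 hpn
    ext1
    · simp only [hy, Prod.smul_fst, smul_eq_mul]
      push_cast
      rw [h0, zero_add]
      ring
    · simp only [hy, Prod.smul_snd, smul_eq_mul]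
      push_cast
      rw [h0, zero_add]
      ring
  -- A zero initial state would make every `χ ℓ` vanish, against the normalisation of their sum.
  · intro h0
    rw [h0] at hm
    have hz : ∀ i : ℕ, χ ((i + 1 : ℕ) : ZMod p) = 0 := by
      intro i
      have h1 := congrArg Prod.fst (hm i)
      rw [(march_eq_add _ _ _ _).1] at h1
      simp only [hy, Prod.fst_zero, Prod.snd_zero, mul_zero, add_zero] at h1
      have h2 := congrArg (fun z => expNeg ^ (i + 1) * z) h1
      simp only [mul_zero] at h2
      rw [← mul_assoc, mul_comm (expNeg ^ (i + 1)), exp_pow_mul_expNeg_pow, one_mul] at h2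
      exact h2.symm
    have hz' : ∀ ℓ : ZMod p, χ ℓ = 0 := by
      intro ℓ
      have := hz (ℓ - 1).val
      rwa [Nat.cast_add, ZMod.natCast_zmod_val, Nat.cast_one, sub_add_cancel] at this
    simp only [hz', Finset.sum_const_zero] at hsum
    have := congrArg constantCoeff hsum
    simp only [map_zero, constantCoeff_C] at this
    exact NeZero.ne p (by exact_mod_cast this.symm)

lemma constantCoeff_aeval {g : PowerSeries ℝ} (h0 : constantCoeff g = 0) (q : Polynomial ℝ) :
    constantCoeff (Polynomial.aeval g q) = q.coeff 0 := by
  conv_lhs => rw [← Polynomial.divX_mul_X_add q]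
  rw [map_add, map_mul, Polynomial.aeval_X, Polynomial.aeval_C, map_add, map_mul, h0,
    show algebraMap ℝ (PowerSeries ℝ) = C from rfl, constantCoeff_C]
  ring

/-- When `q.coeff 1 ≠ 0` the cofactor `Q` is a unit, so `q` is injective, and invertible by
iteration, on series without constant term. -/
lemma aeval_sub_aeval (q : Polynomial ℝ) {g g₁ : PowerSeries ℝ}
    (h0 : constantCoeff g = 0) (h1 : constantCoeff g₁ = 0) :
    ∃ Q : PowerSeries ℝ, constantCoeff Q = q.coeff 1 ∧
      Polynomial.aeval g q - Polynomial.aeval g₁ q = (g - g₁) * Q := by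
  obtain ⟨k, hk⟩ := Polynomial.sub_dvd_eval_sub g g₁ (q.divX.map (algebraMap ℝ (PowerSeries ℝ)))
  simp only [Polynomial.eval_map_algebraMap] at hk
  refine ⟨Polynomial.aeval g q.divX + k * g₁, ?_, ?_⟩
  · rw [map_add, map_mul, h1, constantCoeff_aeval h0, Polynomial.coeff_divX]
    ring
  · conv_lhs => rw [← Polynomial.divX_mul_X_add q]
    simp only [map_add, map_mul, Polynomial.aeval_X, Polynomial.aeval_C]
    linear_combination g₁ * hk

lemma eq_of_aeval_eq {q : Polynomial ℝ} (hq : q.coeff 1 ≠ 0) {g g₁ : PowerSeries ℝ}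
    (h0 : constantCoeff g = 0) (h1 : constantCoeff g₁ = 0)
    (h : Polynomial.aeval g q = Polynomial.aeval g₁ q) : g = g₁ := by
  obtain ⟨Q, hQ, hfac⟩ := aeval_sub_aeval q h0 h1
  rw [h, sub_self] at hfac
  rcases mul_eq_zero.1 hfac.symm with hz | hz
  · exact sub_eq_zero.1 hz
  · rw [hz, map_zero] at hQ
    exact absurd hQ.symm hq

/-- Inversion of a polynomial at a simple point, in formal power series. -/
lemma exists_aeval_eq {q : Polynomial ℝ} (hq : q.coeff 1 ≠ 0) {h : PowerSeries ℝ}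
    (hh : constantCoeff h = q.coeff 0) :
    ∃ g : PowerSeries ℝ, constantCoeff g = 0 ∧ Polynomial.aeval g q = h := by
  -- Newton's iteration with the slope frozen at 0. It is a contraction in the `X`-adic sense: each
  -- application gains one correct coefficient.
  set F : PowerSeries ℝ → PowerSeries ℝ :=
    fun g => g - C (q.coeff 1)⁻¹ * (Polynomial.aeval g q - h) with hF
  have hF0 : ∀ g, constantCoeff g = 0 → constantCoeff (F g) = 0 := by
    intro g h0
    simp only [hF, map_sub, map_mul, constantCoeff_aeval h0, h0, hh]
    ring
  have hFX : ∀ (m : ℕ) (g g₁ : PowerSeries ℝ), constantCoeff g = 0 → constantCoeff g₁ = 0 →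
      X ^ m ∣ g - g₁ → X ^ (m + 1) ∣ F g - F g₁ := by
    intro m g g₁ h0 h1 hd
    obtain ⟨Q, hQ, hfac⟩ := aeval_sub_aeval q h0 h1
    have e : F g - F g₁ = (g - g₁) * (1 - C (q.coeff 1)⁻¹ * Q) := by
      simp only [hF]
      linear_combination (-C (q.coeff 1)⁻¹) * hfac
    rw [e, pow_succ]
    apply mul_dvd_mul hd
    rw [X_dvd_iff]
    simp [hQ, hq]
  set G : ℕ → PowerSeries ℝ := fun m => F^[m] 0 with hG
  have hGs : ∀ m, G (m + 1) = F (G m) := fun m => Function.iterate_succ_apply' F m 0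
  have hG0 : ∀ m, constantCoeff (G m) = 0 := by
    intro m
    induction m with
    | zero => simp [hG]
    | succ m ih => rw [hGs]; exact hF0 _ ih
  have hstep : ∀ m, X ^ m ∣ G (m + 1) - G m := by
    intro m
    induction m with
    | zero => simp
    | succ m ih =>
      have := hFX m _ _ (hG0 _) (hG0 _) ih
      rwa [← hGs, ← hGs] at this
  have hcau : ∀ m k, X ^ m ∣ G (m + k) - G m := by
    intro m k
    induction k with
    | zero => simp
    | succ k ih =>
      have := dvd_add ((pow_dvd_pow X (Nat.le_add_right m k)).trans (hstep (m + k))) ih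
      simpa [← add_assoc] using this
  -- The coefficient of order `k` no longer changes from the iterate `k + 1` on.
  set g : PowerSeries ℝ := PowerSeries.mk fun k => coeff k (G (k + 1)) with hg
  have hlim : ∀ m, X ^ m ∣ g - G m := by
    intro m
    rw [X_pow_dvd_iff]
    intro k hk
    have := X_pow_dvd_iff.1 (hcau (k + 1) (m - (k + 1))) k (Nat.lt_succ_self k)
    rw [Nat.add_sub_cancel' hk, map_sub] at this
    rw [map_sub, hg, coeff_mk]
    linarith
  have hg0 : constantCoeff g = 0 := by
    rw [← coeff_zero_eq_constantCoeff_apply, hg, coeff_mk, coeff_zero_eq_constantCoeff_apply]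
    exact hG0 1
  have hfix : F g = g := by
    rw [← sub_eq_zero]
    ext k
    have h1 := hFX (k + 1) g (G (k + 1)) hg0 (hG0 _) (hlim (k + 1))
    rw [← hGs] at h1
    have h2 := dvd_sub h1 (hlim (k + 2))
    rw [sub_sub_sub_cancel_right] at h2
    simpa using X_pow_dvd_iff.1 h2 k (by omega)
  refine ⟨g, hg0, ?_⟩
  have : C (q.coeff 1)⁻¹ * (Polynomial.aeval g q - h) = 0 := by
    simp only [hF] at hfix
    linear_combination -hfix
  rcases mul_eq_zero.1 this with hz | hz
  · exfalso
    have := congrArg (constantCoeff (R := ℝ)) hz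
    simp [hq] at this
  · exact sub_eq_zero.1 hz

/-- The characteristic equation has a slow root, with an eigenvector of nonzero mean. -/
lemma isHomogenisedSymbol_of_aeval {κ : ZMod p → ℝ} (hκ : ∀ ℓ, 0 < κ ℓ) {g : PowerSeries ℝ}
    (h0 : constantCoeff g = 0)
    (hg : Polynomial.aeval g (marchTrace (resistance κ) p) = PowerSeries.exp ℝ ^ p + expNeg ^ p) :
    IsHomogenisedSymbol κ g := by
  set e := PowerSeries.exp ℝ with he
  have hee : e * expNeg = 1 := exp_mul_expNeg
  have heep : e ^ p * expNeg ^ p = 1 := exp_pow_mul_expNeg_pow p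
  have hce : constantCoeff e = 1 := constantCoeff_exp
  have hcn : constantCoeff expNeg = 1 := by
    have := congrArg (constantCoeff (R := ℝ)) hee
    rwa [map_mul, hce, one_mul, map_one] at this
  set ρ : ℕ → PowerSeries ℝ := fun i => algebraMap ℝ (PowerSeries ℝ) (resistance κ i) with hρ
  have hl : march ρ g (1, 0) p = _ := march_aeval_left (resistance κ) g p
  have hr : march ρ g (0, 1) p = _ := march_aeval_right (resistance κ) g p
  have hdet := march_det ρ g p
  rw [marchTrace, map_add] at hg
  -- The first row of `(matrix - e ^ p) v = 0` holds by this choice of `v`; the second is the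
  -- characteristic equation.
  set v : PowerSeries ℝ × PowerSeries ℝ :=
    ((march ρ g (0, 1) p).1, e ^ p - (march ρ g (1, 0) p).1) with hv
  have hvp : march ρ g v p = e ^ p • v := by
    have hg' : (march ρ g (1, 0) p).1 + (march ρ g (0, 1) p).2 = e ^ p + expNeg ^ p := by
      rw [hl, hr]; exact hg
    ext1
    · rw [(march_eq_add ρ g v p).1]
      simp only [hv, Prod.smul_fst, smul_eq_mul]
      ring
    · rw [march_snd ρ g v p]
      simp only [hv, Prod.smul_snd, smul_eq_mul]
      linear_combination e ^ p * hg' - hdet + heep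
  -- At `s = 0` the vector `v` is the total resistance with zero flux, so the march is constant.
  -- This makes the sum `σ` of the `χ ℓ` invertible below.
  have hcm : ∀ i, constantCoeff (march ρ g v i).1
      = ∑ j ∈ Finset.range p, resistance κ (j + 1) := by
    intro i
    have h := march_map ρ g (constantCoeff (R := ℝ)) v i
    have hρ0 : (fun j => constantCoeff (ρ j)) = resistance κ := by
      funext j
      exact constantCoeff_C _
    rw [hρ0, h0, march_at_zero] at h
    have h1 := congrArg Prod.fst h
    simp only at h1
    rw [← h1, hv, hl, hr]
    simp only [map_sub, map_pow, hce, constantCoeff_aeval h0, one_pow, (marchPoly_coeff _ p).1,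
      (marchPoly_coeff _ p).2.1]
    ring
  have hper : ∀ (i k : ℕ), march ρ g v (i + k * p) = (e ^ p) ^ k • march ρ g v i := by
    intro i k
    induction k with
    | zero => simp
    | succ k ih =>
      rw [show i + (k + 1) * p = (i + k * p) + p by ring, march_add, hvp, march_smul, ih, smul_smul,
        pow_succ']
      intro j
      simp [hρ, resistance]
  -- The phase factor is removed again. The offset by one is there because step `i` of the march
  -- holds the value at the point `i + 1`.
  set χ : ZMod p → PowerSeries ℝ :=
    fun ℓ => expNeg ^ ((ℓ - 1).val + 1) * (march ρ g v (ℓ - 1).val).1 with hχ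
  have hχn : ∀ i : ℕ, χ ((i + 1 : ℕ) : ZMod p) = expNeg ^ (i + 1) * (march ρ g v i).1 := by
    intro i
    have hval : (((i + 1 : ℕ) : ZMod p) - 1).val = i % p := by
      rw [Nat.cast_add, Nat.cast_one, add_sub_cancel_right, ZMod.val_natCast]
    have hi : i = i % p + i / p * p := (Nat.mod_add_div' i p).symm
    simp only [hχ, hval]
    conv_rhs => rw [hi, hper, Prod.smul_fst, smul_eq_mul]
    have h2 : expNeg ^ (i / p * p) * (e ^ p) ^ (i / p) = 1 := by
      rw [mul_comm (i / p), pow_mul, ← mul_pow, mul_comm, heep, one_pow]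
    rw [show i % p + i / p * p + 1 = (i % p + 1) + i / p * p by ring, pow_add expNeg (i % p + 1)]
    linear_combination (-expNeg ^ (i % p + 1) * (march ρ g v (i % p)).1) * h2
  have heq : ∀ ℓ, g * χ ℓ =
      C (κ ℓ) * (e * χ (ℓ + 1) - χ ℓ) + C (κ (ℓ - 1)) * (expNeg * χ (ℓ - 1) - χ ℓ) := by
    intro ℓ
    obtain ⟨i, rfl⟩ : ∃ i : ℕ, ((i + 2 : ℕ) : ZMod p) = ℓ :=
      ⟨(ℓ - 2).val, by rw [Nat.cast_add, ZMod.natCast_zmod_val]; push_cast; ring⟩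
    have h := march_lattice ρ g (fun i => C (κ (i : ZMod p))) (by
      intro i
      rw [hρ, show algebraMap ℝ (PowerSeries ℝ) = C from rfl, ← map_mul, resistance,
        mul_inv_cancel₀ (hκ _).ne', map_one]) v i
    rw [show ((i + 2 : ℕ) : ZMod p) - 1 = ((i + 1 : ℕ) : ZMod p) by push_cast; ring,
      show ((i + 2 : ℕ) : ZMod p) + 1 = ((i + 2 + 1 : ℕ) : ZMod p) by push_cast; ring,
      hχn (i + 2), hχn i, show i + 2 = i + 1 + 1 by rfl, hχn (i + 1)]
    linear_combination expNeg ^ (i + 2) * h - C (κ ((i + 2 : ℕ) : ZMod p))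
      * expNeg ^ (i + 2) * (march ρ g v (i + 2)).1 * hee
  set σ := ∑ ℓ, χ ℓ with hσ
  have hcσ : constantCoeff σ ≠ 0 := by
    have : ∀ ℓ, constantCoeff (χ ℓ) = ∑ j ∈ Finset.range p, resistance κ (j + 1) := by
      intro ℓ
      simp only [hχ, map_mul, map_pow, hcn, one_pow, one_mul, hcm]
    rw [hσ, map_sum]
    simp only [this, Finset.sum_const, Finset.card_univ, ZMod.card, nsmul_eq_mul]
    exact mul_ne_zero (NeZero.ne _) (sum_resistance_pos hκ (NeZero.one_le)).ne'
  -- The equations are linear, so the eigenvector may be rescaled to have mean 1.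
  refine ⟨h0, fun ℓ => C (p : ℝ) * σ⁻¹ * χ ℓ, ?_, ?_⟩
  · rw [← Finset.mul_sum, ← hσ, mul_assoc, PowerSeries.inv_mul_cancel _ hcσ, mul_one]
  · intro ℓ
    have := heq ℓ
    rw [← he]
    change _ = C (κ ℓ) * _ + C (κ (ℓ - 1)) * (expNeg * _ - _)
    linear_combination C (p : ℝ) * σ⁻¹ * this

/-- The homogenisation exists. -/
lemma exists_isHomogenisedSymbol {κ : ZMod p → ℝ} (hκ : ∀ ℓ, 0 < κ ℓ) :
    ∃ g, IsHomogenisedSymbol κ g := by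
  obtain ⟨g, h0, hg⟩ := exists_aeval_eq (marchTrace_coeff_one_pos hκ (NeZero.one_le (n := p))).ne'
    (h := PowerSeries.exp ℝ ^ p + expNeg ^ p) (by
      rw [marchTrace_coeff_zero, ← coeff_zero_eq_constantCoeff_apply, map_add, coeff_exp_pow,
        coeff_expNeg_pow]
      norm_num)
  exact ⟨g, isHomogenisedSymbol_of_aeval hκ h0 hg⟩

lemma IsHomogenisedSymbol.unique {κ : ZMod p → ℝ} (hκ : ∀ ℓ, 0 < κ ℓ) {g g₁ : PowerSeries ℝ}
    (hg : IsHomogenisedSymbol κ g) (hg₁ : IsHomogenisedSymbol κ g₁) : g₁ = g :=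
  eq_of_aeval_eq (marchTrace_coeff_one_pos hκ (NeZero.one_le (n := p))).ne' hg₁.1 hg.1
    ((hg₁.marchTrace_aeval hκ dvd_rfl).trans (hg.marchTrace_aeval hκ dvd_rfl).symm)

lemma evalNegHom_C (r : ℝ) : evalNegHom (C r) = C r := by
  ext k
  rw [evalNegHom, coeff_rescale, coeff_C]
  split_ifs with h <;> simp [h]

/-- The right side of the characteristic equation is invariant under `s ↦ -s`, hence so is its
unique slow root. -/
lemma IsHomogenisedSymbol.coeff_odd {κ : ZMod p → ℝ} (hκ : ∀ ℓ, 0 < κ ℓ) {g : PowerSeries ℝ}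
    (hg : IsHomogenisedSymbol κ g) (m : ℕ) : coeff (2 * m + 1) g = 0 := by
  have h := hg.marchTrace_aeval hκ (dvd_refl p)
  have hneg : evalNegHom g = g := by
    apply eq_of_aeval_eq (marchTrace_coeff_one_pos hκ (NeZero.one_le (n := p))).ne' _ hg.1
    · rw [h]
      have h2 := congrArg evalNegHom h
      rw [Polynomial.aeval_def, Polynomial.hom_eval₂] at h2
      have hC : (evalNegHom : PowerSeries ℝ →+* PowerSeries ℝ).comp (algebraMap ℝ (PowerSeries ℝ))
          = algebraMap ℝ (PowerSeries ℝ) := RingHom.ext evalNegHom_C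
      rw [hC] at h2
      rw [Polynomial.aeval_def, h2, map_add]
      ext k
      simp only [evalNegHom, map_add, coeff_rescale, coeff_exp_pow, coeff_expNeg_pow]
      rw [neg_pow (p : ℝ)]
      have : ((-1 : ℝ) ^ k) * (-1) ^ k = 1 := by rw [← mul_pow]; norm_num
      linear_combination ((p : ℝ) ^ k / k.factorial) * this
    · rw [← coeff_zero_eq_constantCoeff_apply, evalNegHom, coeff_rescale,
        coeff_zero_eq_constantCoeff_apply, hg.1, mul_zero]
  have h3 := congrArg (coeff (2 * m + 1)) hneg
  rw [evalNegHom, coeff_rescale, pow_succ, pow_mul] at h3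
  norm_num at h3
  linarith

/-- As `g` starts at `s ^ 2`, the coefficient of `s ^ 2` in the characteristic equation reads K₂ · p
Σ 1/κ = p². -/
lemma IsHomogenisedSymbol.coeff_two {κ : ZMod p → ℝ} (hκ : ∀ ℓ, 0 < κ ℓ) {g : PowerSeries ℝ}
    (hg : IsHomogenisedSymbol κ g) : coeff 2 g = (p : ℝ) / ∑ ℓ, (κ ℓ)⁻¹ := by
  have h := hg.marchTrace_aeval hκ (dvd_refl p)
  set q := marchTrace (resistance κ) p with hq
  have hp0 : (p : ℝ) ≠ 0 := NeZero.ne _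
  obtain ⟨k, hk⟩ : X ^ 2 ∣ g := by
    rw [X_pow_dvd_iff]
    intro m hm
    interval_cases m
    · rw [coeff_zero_eq_constantCoeff_apply]; exact hg.1
    · exact hg.coeff_odd hκ 0
  obtain ⟨Q, hQ, hfac⟩ := aeval_sub_aeval q hg.1 (map_zero _)
  rw [h, hk, sub_zero, mul_assoc] at hfac
  have h2 := congrArg (coeff 2) hfac
  rw [show (2 : ℕ) = 0 + 2 from rfl, coeff_X_pow_mul, coeff_zero_eq_constantCoeff_apply, map_mul,
    hQ, hq, (marchPoly_coeff _ p).2.2.2.2.2, map_sub, map_add, coeff_exp_pow,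
    coeff_expNeg_pow] at h2
  have hz : coeff (0 + 2) (Polynomial.aeval (0 : PowerSeries ℝ) (marchTrace (resistance κ) p))
      = 0 := by
    rw [← Polynomial.coeff_zero_eq_aeval_zero', show algebraMap ℝ (PowerSeries ℝ) = C from rfl,
      coeff_C]
    simp
  have hS := sum_zmod_eq (fun ℓ => (κ ℓ)⁻¹)
  have hSp := sum_resistance_pos hκ (NeZero.one_le (n := p))
  simp only [resistance] at hSp h2
  rw [hS] at hSp h2
  have hck : coeff 2 g = constantCoeff k := by
    rw [hk, show (2 : ℕ) = 0 + 2 from rfl, coeff_X_pow_mul, coeff_zero_eq_constantCoeff_apply]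
  rw [hck, eq_div_iff hSp.ne']
  apply mul_left_cancel₀ hp0
  rw [sub_eq_iff_eq_add] at h2
  have h3 : (p : ℝ) ^ (0 + 2) / ((0 + 2).factorial : ℝ)
      + (-(p : ℝ)) ^ (0 + 2) / ((0 + 2).factorial : ℝ)
      = (p : ℝ) ^ 2 := by
    norm_num [Nat.factorial]
  rw [h3] at h2
  linear_combination -h2 - hz

end Symbol
/-! ### Ensemble -/

/-- Within a patch the change of variable `ℓ = i + φ` follows the diagonals of the ensemble. At the
edges the coupling links `i = n + 1` with `1` and `0` with `n` at equal `ℓ`, hence at equal phase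
because `n = 0` in `ZMod p`. -/
lemma isEnsemblePatchSolution_iff {p : ℕ} (κ : ZMod p → ℝ) (n : ℕ) (hpn : p ∣ n) (L : ℝ)
    (c : Coupling) (N : ℕ) (d : ℝ) (v : ℝ → ℤ → ℤ → ZMod p → ℝ) :
    IsEnsemblePatchSolution c L N n d κ v ↔
      ∀ φ : ZMod p, IsPatchSolution c L N n d (fun ℓ => κ (ℓ + φ))
        (fun t I i => v t I i ((i : ZMod p) + φ)) := by
  have hn0 : ((n : ℤ) : ZMod p) = 0 := by
    rw [Int.cast_natCast]; exact (ZMod.natCast_eq_zero_iff n p).2 hpn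
  constructor
  · intro h φ
    refine ⟨fun t I i => h.periodic _ _ _ _, fun t I => ?_, fun t I => ?_, fun t I i hi => ?_⟩
    · have := h.right_edge t I (1 + φ)
      simp only [Int.cast_add, hn0, zero_add, Int.cast_one]
      exact this
    · have := h.left_edge t I φ
      simp only [hn0, Int.cast_zero, zero_add]
      exact this
    · have := h.ode t I i hi ((i : ZMod p) + φ)
      convert this using 1
      push_cast
      rw [show (i : ZMod p) + 1 + φ = (i : ZMod p) + φ + 1 by ring,
        show (i : ZMod p) - 1 + φ = (i : ZMod p) + φ - 1 by ring]
  · intro h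
    refine ⟨fun t I i ℓ => ?_, fun t I ℓ => ?_, fun t I ℓ => ?_, fun t I i hi ℓ => ?_⟩
    · have := (h (ℓ - i)).periodic t I i
      simpa using this
    · have := (h (ℓ - 1)).right_edge t I
      simp only [Int.cast_add, hn0, zero_add, Int.cast_one, add_sub_cancel] at this
      exact this
    · have := (h ℓ).left_edge t I
      simp only [hn0, Int.cast_zero, zero_add] at this
      exact this
    · have := (h (ℓ - i)).ode t I i hi
      simp only [Int.cast_add, Int.cast_sub, Int.cast_one, add_sub_cancel] at this
      rw [show (i : ZMod p) + 1 + (ℓ - i) = ℓ + 1 by ring,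
        show (i : ZMod p) - 1 + (ℓ - i) = ℓ - 1 by ring] at this
      exact this

/-! ### Linearity and symbols of the couplings -/

lemma diffSq_iterate_add (k : ℕ) (f g : ℤ → ℝ) :
    diffSq^[k] (fun J => f J + g J) = fun J => diffSq^[k] f J + diffSq^[k] g J := by
  induction k with
  | zero => rfl
  | succ k ih =>
    funext J
    simp only [Function.iterate_succ_apply', ih, diffSq]
    ring

lemma diffSq_iterate_zero (k : ℕ) : diffSq^[k] (fun _ => 0) = fun _ => 0 := by
  induction k with
  | zero => rfl
  | succ k ih =>
    funext J
    simp [Function.iterate_succ_apply', ih, diffSq]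

lemma shift_add (c : Coupling) (N : ℕ) (r : ℝ) (f g : ℤ → ℝ) (I : ℤ) :
    c.shift N r (fun J => f J + g J) I = c.shift N r f I + c.shift N r g I := by
  cases c with
  | spectral => simp only [Coupling.shift, spectralShift, mul_add, Finset.sum_add_distrib]
  | lagrangian P =>
    simp only [Coupling.shift, lagrangianShift, diffSq_iterate_add, meanDiff]
    rw [add_add_add_comm, ← Finset.sum_add_distrib]
    congr 1
    exact Finset.sum_congr rfl fun k _ => by ring

lemma shift_zero (c : Coupling) (N : ℕ) (r : ℝ) (I : ℤ) :
    c.shift N r (fun _ => 0) I = 0 := by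
  cases c with
  | spectral => simp [Coupling.shift, spectralShift]
  | lagrangian P => simp [Coupling.shift, lagrangianShift, diffSq_iterate_zero, meanDiff]

lemma shift_sum (c : Coupling) (N : ℕ) (r : ℝ) (s : Finset ℕ) (f : ℕ → ℤ → ℝ) (I : ℤ) :
    c.shift N r (fun J => ∑ j ∈ s, f j J) I = ∑ j ∈ s, c.shift N r (f j) I := by
  induction s using Finset.cons_induction with
  | empty => simpa using shift_zero c N r I
  | cons a s ha ih =>
    simp only [Finset.sum_cons]
    rw [shift_add, ih]

/-- The real harmonic wave of wavenumber `θ` and complex amplitude `z`. -/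
noncomputable def wave (θ : ℝ) (z : ℂ) (x : ℝ) : ℝ :=
  (z * Complex.exp (Complex.I * (θ * x : ℝ))).re

lemma exp_I_mul_ofReal (x : ℝ) :
    Complex.exp (Complex.I * (x : ℝ)) = (Real.cos x : ℂ) + Complex.I * (Real.sin x : ℂ) := by
  rw [mul_comm, Complex.exp_mul_I, Complex.ofReal_cos, Complex.ofReal_sin]
  ring

lemma wave_eq (θ : ℝ) (z : ℂ) (x : ℝ) :
    wave θ z x = z.re * Real.cos (θ * x) - z.im * Real.sin (θ * x) := by
  rw [wave, exp_I_mul_ofReal]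
  simp only [Complex.mul_re, Complex.mul_im, Complex.add_re, Complex.add_im, Complex.I_re,
    Complex.I_im, Complex.ofReal_re, Complex.ofReal_im]
  ring

lemma wave_add (θ : ℝ) (z : ℂ) (x y : ℝ) :
    wave θ z (x + y) = wave θ (z * Complex.exp (Complex.I * (θ * y : ℝ))) x := by
  rw [wave, wave, mul_assoc, ← Complex.exp_add]
  congr 3
  push_cast
  ring

/-- A complex number is the symbol, for the wavenumber `θ`, of the shift by `r`. -/
def IsSymbol (c : Coupling) (N : ℕ) (r θ : ℝ) (a : ℂ) : Prop :=
  ∀ (z : ℂ) (I : ℤ), c.shift N r (fun J : ℤ => wave θ z J) I = wave θ (z * a) I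

/-- The real part of the symbol of the Lagrangian shift. -/
noncomputable def lagrangianRe (P : ℕ) (r θ : ℝ) : ℝ :=
  1 + ∑ k ∈ Finset.Icc 1 P, (∏ l ∈ Finset.range k, (r ^ 2 - (l : ℝ) ^ 2)) / ((2 * k).factorial : ℝ)
    * (2 * Real.cos θ - 2) ^ k

/-- The imaginary part of the symbol of the Lagrangian shift. -/
noncomputable def lagrangianIm (P : ℕ) (r θ : ℝ) : ℝ :=
  ∑ k ∈ Finset.Icc 1 P, (∏ l ∈ Finset.range k, (r ^ 2 - (l : ℝ) ^ 2)) / ((2 * k).factorial : ℝ)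
    * ((2 * k / r) * Real.sin θ * (2 * Real.cos θ - 2) ^ (k - 1))

lemma diffSq_wave (θ : ℝ) (z : ℂ) :
    diffSq (fun J : ℤ => wave θ z J) = fun J : ℤ => wave θ ((2 * Real.cos θ - 2 : ℝ) * z) J := by
  funext J
  simp only [diffSq, Int.cast_add, Int.cast_sub, Int.cast_one, wave_eq, mul_add, mul_sub, mul_one,
    Real.cos_add, Real.sin_add, Real.cos_sub, Real.sin_sub, Complex.re_ofReal_mul,
    Complex.im_ofReal_mul]
  ring

lemma diffSq_iterate_wave (θ : ℝ) (k : ℕ) (z : ℂ) :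
    diffSq^[k] (fun J : ℤ => wave θ z J)
      = fun J : ℤ => wave θ (((2 * Real.cos θ - 2) ^ k : ℝ) * z) J := by
  induction k with
  | zero => simp
  | succ k ih =>
    rw [Function.iterate_succ_apply', ih, diffSq_wave]
    funext J
    congr 1
    push_cast
    ring

lemma meanDiff_wave (θ : ℝ) (z : ℂ) :
    meanDiff (fun J : ℤ => wave θ z J) = fun J : ℤ =>
      wave θ (Complex.I * (Real.sin θ : ℝ) * z) J := by
  funext J
  simp only [meanDiff, Int.cast_add, Int.cast_sub, Int.cast_one, wave_eq, mul_add, mul_sub, mul_one,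
    Real.cos_add, Real.sin_add, Real.cos_sub, Real.sin_sub]
  simp only [Complex.mul_re, Complex.mul_im, Complex.I_re, Complex.I_im, Complex.ofReal_re,
    Complex.ofReal_im]
  ring

/-- Waves are eigenfunctions: δ² has symbol 2 cos θ - 2 and μδ has symbol i sin θ. -/
lemma isSymbol_lagrangian (P N : ℕ) (r θ : ℝ) :
    IsSymbol (.lagrangian P) N r θ ⟨lagrangianRe P r θ, lagrangianIm P r θ⟩ := by
  intro z I
  simp only [Coupling.shift, lagrangianShift, diffSq_iterate_wave, meanDiff_wave]
  simp only [wave_eq, Complex.mul_re, Complex.mul_im, Complex.I_re, Complex.I_im, Complex.ofReal_re,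
    Complex.ofReal_im, lagrangianRe, lagrangianIm]
  set c := Real.cos (θ * I)
  set s := Real.sin (θ * I)
  rw [show ∀ R T : ℝ, (z.re * (1 + R) - z.im * T) * c - (z.re * T + z.im * (1 + R)) * s
    = z.re * c - z.im * s + (R * (z.re * c - z.im * s) + T * (-z.im * c - z.re * s)) from
    fun R T => by ring, Finset.sum_mul, Finset.sum_mul, ← Finset.sum_add_distrib]
  congr 1
  exact Finset.sum_congr rfl fun k _ => by ring

lemma lagrangianRe_neg (P : ℕ) (r θ : ℝ) : lagrangianRe P (-r) θ = lagrangianRe P r θ := by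
  simp [lagrangianRe]

lemma lagrangianIm_neg (P : ℕ) (r θ : ℝ) : lagrangianIm P (-r) θ = -lagrangianIm P r θ := by
  rw [lagrangianIm, lagrangianIm, ← Finset.sum_neg_distrib]
  exact Finset.sum_congr rfl fun k _ => by rw [neg_sq, div_neg]; ring

open Complex in
lemma sum_exp_eq (N : ℕ) (hN : 1 ≤ N) (m : ℤ) :
    ∑ J ∈ Finset.range N, exp (I * (2 * Real.pi * m * J / N : ℝ))
      = if (N : ℤ) ∣ m then (N : ℂ) else 0 := by
  have hN0 : (N : ℂ) ≠ 0 := by exact_mod_cast (by omega : N ≠ 0)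
  have hterm : ∀ J : ℕ, exp (I * (2 * Real.pi * m * J / N : ℝ))
      = exp (m * (2 * Real.pi * I) / N) ^ J := by
    intro J
    rw [← exp_nat_mul]
    congr 1
    push_cast
    ring
  simp only [hterm]
  split_ifs with h
  · obtain ⟨q, rfl⟩ := h
    have : exp (((N : ℤ) * q : ℤ) * (2 * Real.pi * I) / N) = 1 := by
      rw [exp_eq_one_iff]
      exact ⟨q, by push_cast; field_simp⟩
    simp only [this, one_pow, Finset.sum_const, Finset.card_range, nsmul_eq_mul, mul_one]
  · have hne : exp (m * (2 * Real.pi * I) / N) ≠ 1 := by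
      intro h1
      obtain ⟨q, hq⟩ := exp_eq_one_iff.1 h1
      apply h
      refine ⟨q, ?_⟩
      have h2 : (2 * Real.pi * I : ℂ) ≠ 0 := Complex.two_pi_I_ne_zero
      have : (m : ℂ) = N * q := by
        field_simp at hq
        exact hq
      exact_mod_cast this
    rw [geom_sum_eq hne, ← exp_nat_mul, mul_div_cancel₀ _ hN0, exp_int_mul_two_pi_mul_I, sub_self,
      zero_div]

open Complex in
-- Taking the real part of the weight pairs each `q` with `-q`. Discrete orthogonality then keeps
-- only `q = j` and `q = -j`, each contributing half of the exact shift. The hypothesis `2 * j < N`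
-- places both in the range of summation and excludes aliases.
lemma isSymbol_spectral (N : ℕ) (j : ℕ) (hj : 2 * j < N) (r : ℝ) :
    IsSymbol .spectral N r (2 * Real.pi * j / N) (exp (I * (r * (2 * Real.pi * j / N) : ℝ))) := by
  intro z K
  have hN : (1 : ℕ) ≤ N := by omega
  have hN0 : (N : ℂ) ≠ 0 := by exact_mod_cast (by omega : N ≠ 0)
  have hw : ∀ J : ℕ, spectralWeight N r (K - (J : ℤ)) * wave (2 * Real.pi * j / N) z ((J : ℤ) : ℝ)
      = (z * ((1 / (N : ℂ)) * ∑ q ∈ Finset.Ioc ((-(N : ℤ)) / 2) ((N : ℤ) / 2),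
        (exp (I * (2 * Real.pi * q * (K + r) / N : ℝ))
            * exp (I * (2 * Real.pi * ((j - q : ℤ) : ℝ) * J / N : ℝ))
          + exp (I * (-(2 * Real.pi * q * (K + r) / N) : ℝ))
            * exp (I * (2 * Real.pi * ((j + q : ℤ) : ℝ) * J / N : ℝ))) / 2)).re := by
    intro J
    rw [wave, ← re_ofReal_mul]
    congr 1
    rw [mul_left_comm]
    congr 1
    rw [spectralWeight, ofReal_mul, mul_assoc]
    push_cast
    congr 1
    rw [Finset.sum_mul]
    refine Finset.sum_congr rfl fun q _ => ?_
    have hre : ∀ x : ℝ, ((exp (I * (x : ℝ))).re : ℂ)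
        = (exp (I * (x : ℝ)) + exp (I * ((-x : ℝ) : ℂ))) / 2 := by
      intro x
      rw [exp_I_mul_ofReal, exp_I_mul_ofReal, Real.cos_neg, Real.sin_neg]
      simp only [add_re, mul_re, I_re, I_im, ofReal_re, ofReal_im]
      push_cast
      ring
    have := hre (2 * Real.pi * (q : ℝ) * (((K - (J : ℤ) : ℤ) : ℝ) + r) / (N : ℝ))
    push_cast at this ⊢
    rw [this, div_mul_eq_mul_div, add_mul, ← exp_add, ← exp_add, ← exp_add, ← exp_add]
    congr 3
    · ring
    · ring
  simp only [Coupling.shift, spectralShift]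
  rw [Finset.sum_congr rfl fun J _ => hw J, ← Complex.re_sum, ← Finset.mul_sum, ← Finset.mul_sum,
    Finset.sum_comm, wave, mul_assoc z]
  congr 2
  simp only [← Finset.sum_div, Finset.sum_add_distrib, ← Finset.mul_sum]
  simp only [sum_exp_eq N hN]
  have h1 : ∑ q ∈ Finset.Ioc ((-(N : ℤ)) / 2) ((N : ℤ) / 2),
      exp (I * (2 * Real.pi * q * (K + r) / N : ℝ)) * (if (N : ℤ) ∣ (j - q) then (N : ℂ) else 0)
      = exp (I * (2 * Real.pi * j * (K + r) / N : ℝ)) * N := by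
    rw [Finset.sum_eq_single (j : ℤ)]
    · simp
    · intro q hq hne
      rw [if_neg, mul_zero]
      intro hd
      rw [Finset.mem_Ioc] at hq
      apply hne
      have := Int.eq_zero_of_abs_lt_dvd hd (by rw [abs_lt]; omega)
      omega
    · intro hnot
      exact absurd (Finset.mem_Ioc.2 (by omega)) hnot
  have h2 : ∑ q ∈ Finset.Ioc ((-(N : ℤ)) / 2) ((N : ℤ) / 2),
      exp (I * (-(2 * Real.pi * q * (K + r) / N) : ℝ))
        * (if (N : ℤ) ∣ (j + q) then (N : ℂ) else 0)
      = exp (I * (2 * Real.pi * j * (K + r) / N : ℝ)) * N := by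
    rw [Finset.sum_eq_single (-j : ℤ)]
    · simp only [add_neg_cancel, dvd_zero, if_true]
      congr 4
      push_cast
      ring
    · intro q hq hne
      rw [if_neg, mul_zero]
      intro hd
      rw [Finset.mem_Ioc] at hq
      apply hne
      have := Int.eq_zero_of_abs_lt_dvd hd (by rw [abs_lt]; omega)
      omega
    · intro hnot
      exact absurd (Finset.mem_Ioc.2 (by omega)) hnot
  rw [h1, h2, ← exp_add]
  rw [show ∀ x : ℂ, 1 / (N : ℂ) * ((x * N + x * N) / 2) = x from fun x => by field_simp; ring]
  congr 1
  push_cast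
  ring

/-! ### Accuracy of the symbols -/

/-- The symbol `a` approximates `exp (i r θ)` with the accuracy needed for consistency of
order `2M`. -/
structure SymbolBound (M : ℕ) (C r θ : ℝ) (a : ℂ) : Prop where
  re : |a.re - Real.cos (r * θ)| ≤ C * ((r * θ) ^ 2 * θ ^ (2 * M))
  normSq : |Complex.normSq a - 1| ≤ C * ((r * θ) ^ 2 * θ ^ (2 * M))
  sub_one : ‖a - 1‖ ≤ C * (r * θ)

lemma norm_exp_I_sub_one_le (x : ℝ) : ‖Complex.exp (Complex.I * (x : ℝ)) - 1‖ ≤ |x| := by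
  simpa using Real.norm_exp_I_mul_ofReal_sub_one_le (x := x)

lemma symbolBound_spectral (M : ℕ) {r θ : ℝ} (hr : 0 ≤ r) (hθ : 0 ≤ θ) :
    SymbolBound M 1 r θ (Complex.exp (Complex.I * (r * θ : ℝ))) := by
  refine ⟨?_, ?_, ?_⟩
  · rw [exp_I_mul_ofReal]
    simp only [Complex.add_re, Complex.mul_re, Complex.ofReal_re, Complex.ofReal_im, Complex.I_re,
      Complex.I_im]
    rw [show ∀ c s : ℝ, c + (0 * s - 1 * 0) - c = 0 from fun c s => by ring, abs_zero]
    positivity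
  · rw [exp_I_mul_ofReal]
    simp only [Complex.normSq_apply, Complex.add_re, Complex.add_im, Complex.mul_re, Complex.mul_im,
      Complex.ofReal_re, Complex.ofReal_im, Complex.I_re, Complex.I_im]
    rw [show ∀ c s : ℝ, (c + (0 * s - 1 * 0)) * (c + (0 * s - 1 * 0))
      + (0 + (0 * 0 + 1 * s)) * (0 + (0 * 0 + 1 * s)) - 1 = s ^ 2 + c ^ 2 - 1 from
      fun c s => by ring, Real.sin_sq_add_cos_sq, sub_self, abs_zero]
    positivity
  · have := norm_exp_I_sub_one_le (r * θ)
    rw [abs_of_nonneg (mul_nonneg hr hθ)] at this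
    rwa [one_mul]

/-- The defect of the Lagrangian symbol in the equation of the exact shift. -/
noncomputable def lagrangianDefect (P : ℕ) (r θ : ℝ) : ℝ :=
  (∏ l ∈ Finset.range (P + 1), (r ^ 2 - (l : ℝ) ^ 2)) / ((2 * P).factorial : ℝ)
    * (2 * Real.cos θ - 2) ^ P

/-- The exact pair S = cos(rθ), T = sin(rθ) satisfies S' = -rT and T' = rS. The factor `2k/r` in the
interpolation formula makes the first equation exact; only the second acquires a defect. -/
lemma hasDerivAt_lagrangianRe (P : ℕ) {r : ℝ} (hr : r ≠ 0) (θ : ℝ) :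
    HasDerivAt (lagrangianRe P r) (-r * lagrangianIm P r θ) θ := by
  have h : ∀ k ∈ Finset.Icc 1 P, HasDerivAt (fun θ => (∏ l ∈ Finset.range k, (r ^ 2 - (l : ℝ) ^ 2))
      / ((2 * k).factorial : ℝ) * (2 * Real.cos θ - 2) ^ k)
      ((∏ l ∈ Finset.range k, (r ^ 2 - (l : ℝ) ^ 2)) / ((2 * k).factorial : ℝ)
        * (k * (2 * Real.cos θ - 2) ^ (k - 1) * (2 * -Real.sin θ))) θ := fun k _ =>
    ((((Real.hasDerivAt_cos θ).const_mul 2).sub_const 2).pow k).const_mul _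
  have h2 : HasDerivAt (lagrangianRe P r) _ θ := (HasDerivAt.fun_sum h).const_add 1
  refine h2.congr_deriv ?_
  rw [lagrangianIm, Finset.mul_sum]
  refine Finset.sum_congr rfl fun k _ => ?_
  field_simp

/-- The defect telescopes: by sin²θ = -w - w²/4 with w = 2 cos θ - 2, the term of order `P + 1`
cancels the defect of order `P` and creates the next one. -/
lemma hasDerivAt_lagrangianIm (P : ℕ) {r : ℝ} (hr : r ≠ 0) (θ : ℝ) :
    HasDerivAt (lagrangianIm P r) (r * lagrangianRe P r θ - lagrangianDefect P r θ / r) θ := by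
  induction P with
  | zero =>
    have : lagrangianIm 0 r = fun _ => 0 := by funext θ; simp [lagrangianIm]
    rw [this]
    refine (hasDerivAt_const θ (0 : ℝ)).congr_deriv ?_
    simp [lagrangianRe, lagrangianDefect]
    field_simp
    ring
  | succ P ih =>
    set c := (∏ l ∈ Finset.range (P + 1), (r ^ 2 - (l : ℝ) ^ 2))
      / ((2 * (P + 1)).factorial : ℝ) with hc
    have hsplit : lagrangianIm (P + 1) r = fun θ => lagrangianIm P r θ
        + c * ((2 * ((P + 1 : ℕ) : ℝ) / r) * (Real.sin θ * (2 * Real.cos θ - 2) ^ P)) := by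
      funext θ
      rw [lagrangianIm, Finset.sum_Icc_succ_top (by omega), lagrangianIm, hc, Nat.add_sub_cancel]
      ring
    have hw : HasDerivAt (fun θ => (2 * Real.cos θ - 2) ^ P)
        (P * (2 * Real.cos θ - 2) ^ (P - 1) * (2 * -Real.sin θ)) θ :=
      (((Real.hasDerivAt_cos θ).const_mul 2).sub_const 2).pow P
    rw [hsplit]
    refine (ih.add ((((Real.hasDerivAt_sin θ).mul hw).const_mul
      (2 * ((P + 1 : ℕ) : ℝ) / r)).const_mul c)).congr_deriv ?_
    have hre : lagrangianRe (P + 1) r θ = lagrangianRe P r θ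
        + c * (2 * Real.cos θ - 2) ^ (P + 1) := by
      rw [lagrangianRe, Finset.sum_Icc_succ_top (by omega), lagrangianRe, hc, add_assoc]
    have hd : lagrangianDefect P r θ = c * ((2 * P + 2) * (2 * P + 1))
        * (2 * Real.cos θ - 2) ^ P := by
      rw [lagrangianDefect, hc, show 2 * (P + 1) = 2 * P + 1 + 1 by ring, Nat.factorial_succ,
        Nat.factorial_succ]
      have : ((2 * P).factorial : ℝ) ≠ 0 := by positivity
      push_cast
      field_simp
      ring
    have hd1 : lagrangianDefect (P + 1) r θ = c * (r ^ 2 - ((P + 1 : ℕ) : ℝ) ^ 2)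
        * (2 * Real.cos θ - 2) ^ (P + 1) := by
      rw [lagrangianDefect, hc, Finset.prod_range_succ]
      ring
    rw [hre, hd, hd1]
    have hs := Real.sin_sq_add_cos_sq θ
    push_cast
    field_simp
    -- The exponent `P - 1` is truncated at `P = 0`, where its prefactor vanishes.
    cases P with
    | zero =>
      simp
      ring
    | succ P =>
      simp only [Nat.add_sub_cancel]
      push_cast
      set w := Real.cos θ
      have : Real.sin θ ^ 2 = 1 - w ^ 2 := by linarith
      rw [← sub_eq_zero]
      ring_nf
      rw [this]
      ring

/-- The factor `l = 0` of the product supplies `r ^ 2`, and |2 cos θ - 2| ≤ θ² the power of `θ`. -/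
lemma abs_lagrangianDefect_le (P : ℕ) :
    ∃ K : ℝ, 0 ≤ K ∧ ∀ r θ : ℝ, 0 ≤ r → r ≤ 1 →
      |lagrangianDefect P r θ| ≤ K * r ^ 2 * θ ^ (2 * P) := by
  refine ⟨∏ l ∈ Finset.range P, ((l : ℝ) + 1) ^ 2, by positivity, fun r θ h0 h1 => ?_⟩
  rw [lagrangianDefect, abs_mul, abs_div, abs_pow, Finset.prod_range_succ', abs_mul,
    Finset.abs_prod]
  have hw : |2 * Real.cos θ - 2| ≤ θ ^ 2 := by
    rw [abs_of_nonpos (by linarith [Real.cos_le_one θ])]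
    linarith [Real.one_sub_sq_div_two_le_cos (x := θ)]
  have hprod : ∏ l ∈ Finset.range P, |r ^ 2 - ((l + 1 : ℕ) : ℝ) ^ 2|
      ≤ ∏ l ∈ Finset.range P, ((l : ℝ) + 1) ^ 2 := by
    refine Finset.prod_le_prod (fun _ _ => abs_nonneg _) fun l _ => ?_
    push_cast
    have hl : (0 : ℝ) ≤ l := Nat.cast_nonneg l
    rw [abs_le]
    constructor <;> nlinarith
  have hf : (1 : ℝ) ≤ |((2 * P).factorial : ℝ)| := by
    rw [abs_of_nonneg (by positivity)]
    exact_mod_cast (2 * P).factorial_pos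
  have h3 : |r ^ 2 - ((0 : ℕ) : ℝ) ^ 2| = r ^ 2 := by simp
  rw [h3, pow_mul]
  calc _ ≤ ((∏ l ∈ Finset.range P, ((l : ℝ) + 1) ^ 2) * r ^ 2) / 1 * (θ ^ 2) ^ P := by gcongr
    _ = _ := by ring

open Complex in
-- Two integrations of the defect. The first bounds the whole symbol with one factor `r`; the
-- second, through S' = -rT, gains the extra `r * θ` for the real part. In the modulus, the weaker
-- bound on the imaginary part is multiplied by sin(rθ) = O(rθ).
lemma symbolBound_lagrangian (P : ℕ) :
    ∃ C : ℝ, 0 ≤ C ∧ ∀ M ≤ P, ∀ r θ : ℝ, 0 < r → r ≤ 1 → 0 ≤ θ → θ ≤ 1 →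
      SymbolBound M C r θ ⟨lagrangianRe P r θ, lagrangianIm P r θ⟩ := by
  obtain ⟨K, hK, hdef⟩ := abs_lagrangianDefect_le P
  -- The summands serve the modulus, the real part and, as `K + 1`, the distance to 1.
  refine ⟨2 * K * (2 + K) + K + 1, by positivity, fun M hM r θ hr hr1 hθ hθ1 => ?_⟩
  -- In the rotating frame the exact symbol is constant, so only the defect drives `Z`.
  set Z : ℝ → ℂ := fun s => ((lagrangianRe P r s : ℂ) + I * (lagrangianIm P r s : ℂ))
    * exp (-I * r * s) with hZ
  have hw0 : lagrangianRe P r 0 = 1 ∧ lagrangianIm P r 0 = 0 := by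
    constructor
    · rw [lagrangianRe, Finset.sum_eq_zero]
      · ring
      · intro k hk
        have : k ≠ 0 := by have := Finset.mem_Icc.1 hk; omega
        simp [this]
    · rw [lagrangianIm, Finset.sum_eq_zero]
      simp
  have hZd : ∀ s : ℝ,
      HasDerivAt Z (-(I * (lagrangianDefect P r s / r : ℝ)) * exp (-I * r * s)) s := by
    intro s
    have h1 := (hasDerivAt_lagrangianRe P hr.ne' s).ofReal_comp
    have h2 := ((hasDerivAt_lagrangianIm P hr.ne' s).ofReal_comp).const_mul I
    have h3 : HasDerivAt (fun s : ℝ => exp (-I * r * s)) (exp (-I * r * s) * (-I * r * 1)) s :=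
      (((hasDerivAt_id (s : ℂ)).const_mul (-I * r)).cexp).comp_ofReal
    refine ((h1.add h2).mul h3).congr_deriv ?_
    simp only [Pi.add_apply]
    push_cast
    linear_combination (-(r : ℂ) * lagrangianIm P r s * exp (-I * r * s)) * I_sq
  have hnorm : ∀ s : ℝ, ‖exp (-I * r * s)‖ = 1 := by
    intro s
    rw [norm_exp]
    simp
  have h1 : ∀ s : ℝ, 0 ≤ s → s ≤ 1 →
      ‖((lagrangianRe P r s : ℂ) + I * (lagrangianIm P r s : ℂ)) - exp (I * (r * s : ℝ))‖
        ≤ K * r * s ^ (2 * P) * s := by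
    intro s hs hs1
    have := norm_image_sub_le_of_norm_deriv_le_segment' (a := 0) (b := s) (C := K * r * s ^ (2 * P))
      (fun x _ => (hZd x).hasDerivWithinAt) (by
        intro x hx
        rw [norm_mul, hnorm, mul_one, norm_neg, norm_mul, norm_I, one_mul, norm_real,
          Real.norm_eq_abs, abs_div, abs_of_pos hr, div_le_iff₀ hr]
        calc _ ≤ K * r ^ 2 * x ^ (2 * P) := hdef r x hr.le hr1
          _ ≤ K * r ^ 2 * s ^ (2 * P) := by
            have := hx.1
            have := hx.2.le
            gcongr
          _ = _ := by ring) s ⟨hs, le_rfl⟩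
    rw [sub_zero] at this
    refine le_trans (le_of_eq ?_) this
    have hz0 : Z 0 = 1 := by simp [hZ, hw0.1, hw0.2]
    have hee : exp (I * (r * s : ℝ)) * exp (-I * r * s) = 1 := by
      rw [← exp_add]; push_cast; rw [show I * (r * s) + -I * r * s = 0 by ring, exp_zero]
    rw [hz0, ← hee]
    simp only [hZ]
    rw [← sub_mul, norm_mul, hnorm, mul_one]
  have him : ∀ s : ℝ, 0 ≤ s → s ≤ 1 →
      |lagrangianIm P r s - Real.sin (r * s)| ≤ K * r * s ^ (2 * P) * s := by
    intro s hs hs1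
    refine le_trans ?_ (h1 s hs hs1)
    refine le_trans (le_of_eq ?_) (abs_im_le_norm _)
    rw [exp_I_mul_ofReal]
    congr 1
    simp only [sub_im, add_im, mul_im, I_re, I_im, ofReal_re, ofReal_im]
    ring
  have hre : |lagrangianRe P r θ - Real.cos (r * θ)| ≤ K * ((r * θ) ^ 2 * θ ^ (2 * P)) := by
    have := norm_image_sub_le_of_norm_deriv_le_segment' (a := 0) (b := θ)
      (C := K * r ^ 2 * θ ^ (2 * P) * θ)
      (f := fun s => lagrangianRe P r s - Real.cos (r * s))
      (f' := fun s => -r * (lagrangianIm P r s - Real.sin (r * s)))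
      (by
        intro x _
        apply HasDerivAt.hasDerivWithinAt
        have hc : HasDerivAt (fun s => Real.cos (r * s)) (-Real.sin (r * x) * (r * 1)) x :=
          ((hasDerivAt_id x).const_mul r).cos
        refine ((hasDerivAt_lagrangianRe P hr.ne' x).sub hc).congr_deriv ?_
        ring) (by
        intro x hx
        rw [norm_mul, norm_neg, Real.norm_eq_abs, Real.norm_eq_abs, abs_of_pos hr]
        have hx0 := hx.1
        have hx1 := hx.2.le
        calc _ ≤ r * (K * r * x ^ (2 * P) * x) := by
              gcongr; exact him x hx0 (hx1.trans hθ1)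
          _ ≤ r * (K * r * θ ^ (2 * P) * θ) := by gcongr
          _ = _ := by ring) θ ⟨hθ, le_rfl⟩
    simp only [hw0.1, mul_zero, Real.cos_zero, sub_self, sub_zero, Real.norm_eq_abs] at this
    refine this.trans (le_of_eq (by ring))
  have hpow : θ ^ (2 * P) ≤ θ ^ (2 * M) := pow_le_pow_of_le_one hθ hθ1 (by omega)
  have hpow1 : θ ^ (2 * P) ≤ 1 := pow_le_one₀ hθ hθ1
  have hrθ1 : r * θ ≤ 1 := mul_le_one₀ hr1 hθ hθ1
  have hrθ0 : 0 ≤ r * θ := by positivity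
  refine ⟨?_, ?_, ?_⟩
  · refine hre.trans ?_
    have : K ≤ 2 * K * (2 + K) + K + 1 := by nlinarith [mul_nonneg hK hK]
    gcongr
  · rw [normSq_apply]
    simp only
    set S := lagrangianRe P r θ
    set T := lagrangianIm P r θ
    set c := Real.cos (r * θ) with hc
    set s := Real.sin (r * θ) with hs
    have hcs : s ^ 2 + c ^ 2 = 1 := Real.sin_sq_add_cos_sq _
    have e1 : S * S + T * T - 1 = (S - c) * ((S - c) + 2 * c) + (T - s) * ((T - s) + 2 * s) := by
      linear_combination hcs
    have hT := him θ hθ hθ1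
    have hs1 : |s| ≤ r * θ := by
      have := Real.abs_sin_le_abs (x := r * θ)
      rwa [abs_of_nonneg hrθ0] at this
    have hc1 : |c| ≤ 1 := Real.abs_cos_le_one _
    have hS2 : |(S - c) + 2 * c| ≤ K + 2 := by
      refine (abs_add_le _ _).trans (add_le_add ?_ ?_)
      · refine hre.trans ?_
        have : (r * θ) ^ 2 * θ ^ (2 * P) ≤ 1 :=
          mul_le_one₀ (pow_le_one₀ hrθ0 hrθ1) (by positivity) hpow1
        nlinarith
      · rw [abs_mul]; norm_num; linarith
    have hT2 : |(T - s) + 2 * s| ≤ (K + 2) * (r * θ) := by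
      refine (abs_add_le _ _).trans ?_
      rw [add_mul]
      refine add_le_add ?_ ?_
      · refine hT.trans ?_
        calc _ = K * θ ^ (2 * P) * (r * θ) := by ring
          _ ≤ K * 1 * (r * θ) := by gcongr
          _ = _ := by ring
      · rw [abs_mul]; norm_num; linarith
    rw [e1]
    calc _ ≤ |S - c| * |(S - c) + 2 * c| + |T - s| * |(T - s) + 2 * s| := by
          refine (abs_add_le _ _).trans ?_
          rw [abs_mul, abs_mul]
      _ ≤ (K * ((r * θ) ^ 2 * θ ^ (2 * P))) * (K + 2)
          + (K * r * θ ^ (2 * P) * θ) * ((K + 2) * (r * θ)) := by gcongr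
      _ = (2 * K * (2 + K)) * ((r * θ) ^ 2 * θ ^ (2 * P)) := by ring
      _ ≤ (2 * K * (2 + K) + K + 1) * ((r * θ) ^ 2 * θ ^ (2 * M)) := by
          gcongr
          linarith
  · have e : (⟨lagrangianRe P r θ, lagrangianIm P r θ⟩ : ℂ)
        = (lagrangianRe P r θ : ℂ) + I * (lagrangianIm P r θ : ℂ) := by
      apply Complex.ext <;> simp
    rw [e]
    have h2 := norm_exp_I_sub_one_le (r * θ)
    rw [abs_of_nonneg hrθ0] at h2
    have h3 := norm_sub_le_norm_sub_add_norm_sub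
      ((lagrangianRe P r θ : ℂ) + I * (lagrangianIm P r θ : ℂ)) (exp (I * (r * θ : ℝ))) 1
    have h4 := h1 θ hθ hθ1
    have h5 : K * r * θ ^ (2 * P) * θ ≤ K * (r * θ) := by
      calc _ = K * θ ^ (2 * P) * (r * θ) := by ring
          _ ≤ K * 1 * (r * θ) := by gcongr
          _ = _ := by ring
    have h6 : 0 ≤ 2 * K * (2 + K) * (r * θ) := by positivity
    linarith

/-! ### The truncated symbol and the bounds near growth rate zero -/

/-- The truncated symbol of the homogenisation at the scaled wavenumber `x`. -/
noncomputable def truncatedSymbol (g : PowerSeries ℝ) (M : ℕ) (x : ℝ) : ℝ :=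
  ∑ m ∈ Finset.Icc 1 M, PowerSeries.coeff (2 * m) g * ((-1) ^ m * x ^ (2 * m))

lemma sum_range_coeff_eq_truncatedSymbol {g : PowerSeries ℝ} (h0 : PowerSeries.coeff 0 g = 0)
    (hodd : ∀ m, PowerSeries.coeff (2 * m + 1) g = 0) (M : ℕ) (x : ℝ) :
    ∑ k ∈ Finset.range (2 * M + 2), ((PowerSeries.coeff k g : ℝ) : ℂ) * (Complex.I * x) ^ k
      = truncatedSymbol g M x := by
  induction M with
  | zero =>
    have h1 := hodd 0
    rw [mul_zero, zero_add] at h1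
    rw [mul_zero, zero_add, Finset.sum_range_succ, Finset.sum_range_one, h0, h1]
    simp [truncatedSymbol]
  | succ M ih =>
    rw [show 2 * (M + 1) + 2 = 2 * M + 2 + 1 + 1 by ring, Finset.sum_range_succ,
      Finset.sum_range_succ, ih, truncatedSymbol, truncatedSymbol,
      Finset.sum_Icc_succ_top (by omega), show 2 * M + 2 + 1 = 2 * (M + 1) + 1 by ring, hodd,
      show 2 * M + 2 = 2 * (M + 1) by ring, mul_pow, pow_mul, Complex.I_sq]
    push_cast
    ring

lemma exists_aeval_bound (q : Polynomial ℝ) :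
    ∃ K : ℝ, 0 ≤ K ∧ ∀ z : ℂ, ‖z‖ ≤ 1 → ‖Polynomial.aeval z q‖ ≤ K := by
  obtain ⟨K, hK⟩ := (isCompact_closedBall (0 : ℂ) 1).exists_bound_of_continuousOn
    (f := fun z => Polynomial.aeval z q) q.continuous_aeval.continuousOn
  exact ⟨max K 0, le_max_right _ _, fun z hz => (hK z (by simpa using hz)).trans (le_max_left _ _)⟩

lemma exists_eval_bound (q : Polynomial ℝ) :
    ∃ K : ℝ, 0 ≤ K ∧ ∀ u : ℝ, |u| ≤ 1 →
      |q.eval u| ≤ K ∧ |q.eval u - q.coeff 0| ≤ K * |u| := by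
  obtain ⟨K, hK0, hK⟩ := exists_aeval_bound q
  obtain ⟨K', hK0', hK'⟩ := exists_aeval_bound q.divX
  have key : ∀ (r : Polynomial ℝ) (u : ℝ), ‖Polynomial.aeval (u : ℂ) r‖ = |r.eval u| := by
    intro r u
    have := Polynomial.aeval_algebraMap_apply ℂ u r
    rw [show algebraMap ℝ ℂ u = (u : ℂ) from rfl] at this
    rw [this, Polynomial.coe_aeval_eq_eval]
    exact Complex.norm_real _
  refine ⟨K + K', by positivity, fun u hu => ⟨?_, ?_⟩⟩
  · have := hK u (by simpa using hu)
    rw [key] at this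
    linarith
  · have := hK' u (by simpa using hu)
    rw [key] at this
    conv_lhs => rw [← Polynomial.divX_mul_X_add q]
    simp only [Polynomial.eval_add, Polynomial.eval_mul, Polynomial.eval_X, Polynomial.eval_C,
      Polynomial.coeff_add, Polynomial.mul_coeff_zero, Polynomial.coeff_X_zero, mul_zero, zero_add,
      Polynomial.coeff_C_zero, add_sub_cancel_right, abs_mul]
    exact mul_le_mul_of_nonneg_right (by linarith) (abs_nonneg u)

/-- The derivative of `q` stays above half its value at 0 on a neighbourhood, so the mean value
inequality applies. -/
lemma exists_slope_bound (q : Polynomial ℝ) (hq : 0 < q.coeff 1) :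
    ∃ δ c : ℝ, 0 < δ ∧ 0 < c ∧ ∀ u v : ℝ, -δ ≤ u → u ≤ v → v ≤ δ →
      c * (v - u) ≤ q.eval v - q.eval u := by
  have h0 : 0 < q.derivative.eval 0 := by
    rwa [← Polynomial.coeff_zero_eq_eval_zero, Polynomial.coeff_derivative, Nat.cast_zero, zero_add,
      zero_add, mul_one]
  have hev : ∀ᶠ u in nhds (0 : ℝ), q.derivative.eval 0 / 2 < q.derivative.eval u :=
    q.derivative.continuous.continuousAt.eventually (lt_mem_nhds (half_lt_self h0))
  obtain ⟨δ, hδ, hb⟩ := Metric.eventually_nhds_iff.1 hev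
  refine ⟨δ / 2, _, half_pos hδ, half_pos h0, fun u v hu huv hv => ?_⟩
  refine (convex_Icc (-(δ / 2)) (δ / 2)).mul_sub_le_image_sub_of_le_deriv
    q.continuous.continuousOn q.differentiable.differentiableOn ?_ u ⟨hu, huv.trans hv⟩ v
    ⟨hu.trans huv, hv⟩ huv
  intro x hx
  rw [Polynomial.deriv]
  have hx' := interior_subset hx
  apply (hb _).le
  rw [Real.dist_eq, sub_zero, abs_lt]
  constructor <;> linarith [hx'.1, hx'.2]

lemma norm_exp_sub_sum_le {m : ℕ} (hm : 0 < m) :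
    ∃ K : ℝ, 0 ≤ K ∧ ∀ z : ℂ, ‖z‖ ≤ 1 →
      ‖Complex.exp z - ∑ k ∈ Finset.range m, z ^ k / k.factorial‖ ≤ K * ‖z‖ ^ m :=
  ⟨_, by positivity, fun z hz => (Complex.exp_bound hz hm).trans (le_of_eq (mul_comm _ _))⟩

/-- The truncated symbol solves the characteristic equation up to its first neglected power. -/
lemma IsHomogenisedSymbol.marchTrace_eval_truncatedSymbol {p : ℕ} [NeZero p] {κ : ZMod p → ℝ}
    (hκ : ∀ ℓ, 0 < κ ℓ) {g : PowerSeries ℝ} (hg : IsHomogenisedSymbol κ g) {n : ℕ}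
    (hpn : p ∣ n) (M : ℕ) :
    ∃ K : ℝ, 0 ≤ K ∧ ∀ x : ℝ, 0 ≤ x → x ≤ 1 → n * x ≤ 1 →
      |(marchTrace (resistance κ) n).eval (truncatedSymbol g M x) - 2 * Real.cos (n * x)|
        ≤ K * x ^ (2 * M + 2) := by
  set τ := marchTrace (resistance κ) n
  have h := hg.marchTrace_aeval hκ hpn
  have hc0 : PowerSeries.coeff 0 g = 0 := by
    rw [PowerSeries.coeff_zero_eq_constantCoeff_apply]; exact hg.1
  set G : Polynomial ℝ := PowerSeries.trunc (2 * M + 2) g with hG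
  set T : Polynomial ℝ := ∑ k ∈ Finset.range (2 * M + 2),
    Polynomial.monomial k (((n : ℝ) ^ k + (-n : ℝ) ^ k) / k.factorial) with hT
  -- The formal characteristic equation modulo `X ^ (2M + 2)` becomes a divisibility of polynomials,
  -- which can be evaluated at `i x` without any convergence of `g`.
  have hdvd : Polynomial.X ^ (2 * M + 2) ∣ Polynomial.aeval G τ - T := by
    rw [Polynomial.X_pow_dvd_iff]
    intro k hk
    have hd1 : (PowerSeries.X : PowerSeries ℝ) ^ (2 * M + 2) ∣ g - (G : PowerSeries ℝ) := by
      rw [PowerSeries.X_pow_dvd_iff]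
      intro m hm
      rw [map_sub, Polynomial.coeff_coe, hG, PowerSeries.coeff_trunc, if_pos hm, sub_self]
    have hd2 := hd1.trans (Polynomial.sub_dvd_eval_sub g (G : PowerSeries ℝ)
      (τ.map (algebraMap ℝ (PowerSeries ℝ))))
    simp only [Polynomial.eval_map_algebraMap] at hd2
    have hco : Polynomial.aeval (G : PowerSeries ℝ) τ
        = ((Polynomial.aeval G τ : Polynomial ℝ) : PowerSeries ℝ) :=
      Polynomial.aeval_algHom_apply (Polynomial.coeToPowerSeries.algHom ℝ) G τ
    rw [hco, h] at hd2
    have := PowerSeries.X_pow_dvd_iff.1 hd2 k hk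
    rw [map_sub, map_add, coeff_exp_pow, coeff_expNeg_pow, Polynomial.coeff_coe] at this
    rw [Polynomial.coeff_sub, hT, Polynomial.finsetSum_coeff]
    simp only [Polynomial.coeff_monomial]
    rw [Finset.sum_ite_eq' (Finset.range (2 * M + 2)) k, if_pos (Finset.mem_range.2 hk), add_div]
    linarith
  obtain ⟨R, hR⟩ := hdvd
  obtain ⟨K₁, hK₁, hb₁⟩ := exists_aeval_bound R
  obtain ⟨K₂, hK₂, hb₂⟩ := norm_exp_sub_sum_le (m := 2 * M + 2) (by omega)
  refine ⟨K₁ + 2 * K₂ * (n : ℝ) ^ (2 * M + 2), by positivity, fun x hx hx1 hnx => ?_⟩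
  have hnI : ‖Complex.I * (x : ℂ)‖ = x := by
    rw [norm_mul, Complex.norm_I, one_mul, Complex.norm_real, Real.norm_eq_abs, abs_of_nonneg hx]
  have hGx : Polynomial.aeval (Complex.I * (x : ℂ)) G = (truncatedSymbol g M x : ℂ) := by
    rw [← sum_range_coeff_eq_truncatedSymbol hc0 (hg.coeff_odd hκ) M x,
      Polynomial.aeval_eq_sum_range'
      (n := 2 * M + 2) (PowerSeries.natDegree_trunc_lt g (2 * M + 1))]
    refine Finset.sum_congr rfl fun k hk => ?_
    rw [PowerSeries.coeff_trunc, if_pos (Finset.mem_range.1 hk), Complex.real_smul]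
  have hev := congrArg (Polynomial.aeval (Complex.I * (x : ℂ))) hR
  rw [map_sub, map_mul, map_pow, Polynomial.aeval_X,
    ← Polynomial.aeval_algHom_apply (Polynomial.aeval (Complex.I * (x : ℂ))) G τ, hGx] at hev
  have hτ : Polynomial.aeval (truncatedSymbol g M x : ℂ) τ
      = ((τ.eval (truncatedSymbol g M x) : ℝ) : ℂ) := by
    have := Polynomial.aeval_algebraMap_apply ℂ (truncatedSymbol g M x) τ
    rwa [Polynomial.coe_aeval_eq_eval] at this
  set z : ℂ := Complex.I * ((n * x : ℝ) : ℂ) with hz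
  have hTx : Polynomial.aeval (Complex.I * (x : ℂ)) T
      = (∑ k ∈ Finset.range (2 * M + 2), z ^ k / k.factorial)
        + ∑ k ∈ Finset.range (2 * M + 2), (-z) ^ k / k.factorial := by
    rw [hT, map_sum, ← Finset.sum_add_distrib]
    refine Finset.sum_congr rfl fun k _ => ?_
    rw [Polynomial.aeval_monomial, show algebraMap ℝ ℂ = Complex.ofRealHom from rfl]
    have e1 : z = (n : ℂ) * (Complex.I * x) := by rw [hz]; push_cast; ring
    have e2 : -z = (-n : ℂ) * (Complex.I * x) := by rw [e1]; ring
    rw [e2, e1, mul_pow, mul_pow]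
    simp only [Complex.ofRealHom_eq_coe]
    push_cast
    ring
  have hzn : ‖z‖ = n * x := by
    rw [hz, norm_mul, Complex.norm_I, one_mul, Complex.norm_real, Real.norm_eq_abs,
      abs_of_nonneg (by positivity)]
  have hcos : ((2 * Real.cos (n * x) : ℝ) : ℂ) = Complex.exp z + Complex.exp (-z) := by
    rw [hz, show -(Complex.I * ((n * x : ℝ) : ℂ)) = Complex.I * ((-(n * x) : ℝ) : ℂ) by
      push_cast; ring, exp_I_mul_ofReal, exp_I_mul_ofReal, Real.cos_neg, Real.sin_neg]
    push_cast
    ring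
  rw [hτ, hTx] at hev
  rw [← Real.norm_eq_abs, ← Complex.norm_real, Complex.ofReal_sub, hcos]
  have e : ((τ.eval (truncatedSymbol g M x) : ℝ) : ℂ) - (Complex.exp z + Complex.exp (-z))
      = (Complex.I * (x : ℂ)) ^ (2 * M + 2) * Polynomial.aeval (Complex.I * (x : ℂ)) R
        - (Complex.exp z - ∑ k ∈ Finset.range (2 * M + 2), z ^ k / k.factorial)
        - (Complex.exp (-z) - ∑ k ∈ Finset.range (2 * M + 2), (-z) ^ k / k.factorial) := by
    linear_combination hev
  rw [e]
  have n1 : ‖(Complex.I * (x : ℂ)) ^ (2 * M + 2) * Polynomial.aeval (Complex.I * (x : ℂ)) R‖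
      ≤ x ^ (2 * M + 2) * K₁ := by
    rw [norm_mul, norm_pow, hnI]
    gcongr
    exact hb₁ _ (hnI.trans_le hx1)
  have n2 := hb₂ z (hzn.trans_le hnx)
  have n3 := hb₂ (-z) (by rw [norm_neg]; exact hzn.trans_le hnx)
  rw [norm_neg] at n3
  rw [hzn] at n2 n3
  refine (norm_sub_le _ _).trans ((add_le_add ((norm_sub_le _ _).trans (add_le_add n1 n2)) n3).trans
    (le_of_eq ?_))
  rw [mul_pow]
  ring

/-- The leading behaviour -K₂x² gives both the size and, K₂ being positive, the sign of the slow
rate. -/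
lemma abs_truncatedSymbol_add_le (g : PowerSeries ℝ) {M : ℕ} (hM : 1 ≤ M) :
    ∃ K : ℝ, 0 ≤ K ∧ ∀ x : ℝ, 0 ≤ x → x ≤ 1 →
      |truncatedSymbol g M x + PowerSeries.coeff 2 g * x ^ 2| ≤ K * x ^ 4 := by
  refine ⟨∑ m ∈ Finset.Ioc 1 M, |PowerSeries.coeff (2 * m) g|, Finset.sum_nonneg fun _ _ =>
    abs_nonneg _, fun x hx hx1 => ?_⟩
  rw [truncatedSymbol, ← Finset.sum_Ioc_add_eq_sum_Icc hM, Finset.sum_mul]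
  rw [show ∀ s : ℝ, s + PowerSeries.coeff (2 * 1) g * ((-1) ^ 1 * x ^ (2 * 1))
    + PowerSeries.coeff 2 g * x ^ 2 = s from fun s => by rw [mul_one]; ring]
  refine (Finset.abs_sum_le_sum_abs _ _).trans (Finset.sum_le_sum fun m hm => ?_)
  rw [abs_mul, abs_mul, abs_pow, abs_neg, abs_one, one_pow, one_mul,
    abs_of_nonneg (pow_nonneg hx (2 * m))]
  have := (Finset.mem_Ioc.1 hm).1
  exact mul_le_mul_of_nonneg_left (pow_le_pow_of_le_one hx hx1 (by omega)) (abs_nonneg _)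

/-! ### Slow modes of the patch scheme -/

variable {p : ℕ}

/-- Here `f` is the flux entering the first point, where the value is 1. Hypothesis `h1` is the
right edge condition. `h2` is the left one, with `y 0` and `y n` expressed by the fluxes; for `a * b
= 1` it reduces to periodicity of the flux up to the factor `a`. -/
lemma exists_patch_field (κ : ZMod p → ℝ) (hκ : ∀ ℓ, 0 < κ ℓ) {n : ℕ} (hn : 1 ≤ n) (hpn : p ∣ n)
    (lam a b f : ℂ)
    (h1 : (march (fun j => algebraMap ℝ ℂ (resistance κ j)) lam (1, f) n).1 = a)
    (h2 : b * (march (fun j => algebraMap ℝ ℂ (resistance κ j)) lam (1, f) n).2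
      = f + κ 0 * (a * b - 1)) :
    ∃ y : ℤ → ℂ,
      (∀ i : ℕ, y (i + 1) = (march (fun j => algebraMap ℝ ℂ (resistance κ j)) lam (1, f) i).1) ∧
      y 0 = b * y n ∧
      ∀ i ∈ Finset.Icc (1 : ℤ) n, lam * y i
        = κ (i : ZMod p) * (y (i + 1) - y i) + κ ((i - 1 : ℤ) : ZMod p) * (y (i - 1) - y i) := by
  set ρ : ℕ → ℂ := fun j => algebraMap ℝ ℂ (resistance κ j) with hρ
  -- The value `1 - ρ 0 * f` is the step back from the first point to `0`; at negative indices it is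
  -- a mere default.
  set y : ℤ → ℂ := fun i => if i ≤ 0 then 1 - ρ 0 * f else (march ρ lam (1, f) (i - 1).toNat).1
    with hy
  have hκρ : ∀ i : ℕ, (κ (i : ZMod p) : ℂ) * ρ i = 1 := by
    intro i
    simp only [hρ, resistance, Complex.coe_algebraMap, Complex.ofReal_inv]
    exact mul_inv_cancel₀ (Complex.ofReal_ne_zero.2 (hκ _).ne')
  have hys : ∀ i : ℕ, y (i + 1) = (march ρ lam (1, f) i).1 := by
    intro i
    simp only [hy]
    rw [if_neg (by omega), add_sub_cancel_right, Int.toNat_natCast]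
  have hy0 : y 0 = 1 - ρ 0 * f := by simp [hy]
  have hρn : ρ n = ρ 0 := by
    simp [hρ, resistance, (ZMod.natCast_eq_zero_iff n p).2 hpn]
  refine ⟨y, hys, ?_, ?_⟩
  · obtain ⟨j, rfl⟩ : ∃ j, n = j + 1 := ⟨n - 1, by omega⟩
    rw [hy0, Nat.cast_add, Nat.cast_one, hys]
    have h3 := march_succ_fst ρ lam (1, f) j
    rw [h1, hρn] at h3
    have h4 := hκρ 0
    rw [Nat.cast_zero] at h4
    linear_combination b * h3 + ρ 0 * h2 + (a * b - 1) * h4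
  · intro i hi
    rw [Finset.mem_Icc] at hi
    obtain ⟨k, rfl⟩ : ∃ k : ℕ, i = k + 1 := ⟨(i - 1).toNat, by omega⟩
    rw [add_sub_cancel_right, hys,
      show ((k : ℤ) + 1 + 1) = ((k + 1 : ℕ) : ℤ) + 1 by push_cast; ring,
      hys]
    cases k with
    | zero =>
      have h4 := hκρ 0
      have h5 := hκρ 1
      simp only [Nat.cast_zero, zero_add, Int.cast_one, Int.cast_zero, Nat.cast_one] at *
      rw [hy0, show (1 : ℕ) = 0 + 1 from rfl, march_succ_fst, march_succ_snd]
      simp only [march_zero, zero_add]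
      linear_combination f * h4 - (f + lam * 1) * h5
    | succ j =>
      have h6 := march_lattice ρ lam (fun i => (κ (i : ZMod p) : ℂ)) hκρ (1, f) j
      rw [show ((j + 1 : ℕ) : ℤ) = (j : ℤ) + 1 by push_cast; ring, hys]
      push_cast at h6 ⊢
      rw [show (j : ZMod p) + 1 + 1 = (j : ZMod p) + 2 by ring]
      exact h6



lemma exists_marchPoly_bound (ρ : ℕ → ℝ) (n : ℕ) :
    ∃ K : ℝ, 0 ≤ K ∧ ∀ i ≤ n, ∀ u : ℝ, |u| ≤ 1 →
      |(marchPoly ρ (1, 0) i).1.eval u - 1| ≤ K * |u| ∧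
      |(marchPoly ρ (0, 1) i).1.eval u| ≤ K ∧
      |(marchPoly ρ (0, 1) i).1.eval u - ∑ j ∈ Finset.range i, ρ (j + 1)| ≤ K * |u| ∧
      |(marchPoly ρ (0, 1) i).2.eval u| ≤ K := by
  choose Ka ha hA using fun i => exists_eval_bound (marchPoly ρ (1, 0) i).1
  choose Kb hb hB using fun i => exists_eval_bound (marchPoly ρ (0, 1) i).1
  choose Kd hd hD using fun i => exists_eval_bound (marchPoly ρ (0, 1) i).2
  have hpos : ∀ i, 0 ≤ Ka i + Kb i + Kd i := fun i =>
    add_nonneg (add_nonneg (ha i) (hb i)) (hd i)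
  refine ⟨∑ i ∈ Finset.range (n + 1), (Ka i + Kb i + Kd i), Finset.sum_nonneg fun i _ => hpos i,
    fun i hi u hu => ?_⟩
  have hle := Finset.single_le_sum (f := fun i => Ka i + Kb i + Kd i) (fun i _ => hpos i)
    (Finset.mem_range.2 (Nat.lt_succ_of_le hi))
  have h1 := (hA i u hu).2
  have h2 := hB i u hu
  have h3 := (hD i u hu).1
  rw [(marchPoly_coeff ρ i).1] at h1
  rw [(marchPoly_coeff ρ i).2.1] at h2
  have hu0 := abs_nonneg u
  have := ha i
  have := hb i
  have := hd i
  refine ⟨h1.trans ?_, h2.1.trans ?_, h2.2.trans ?_, h3.trans ?_⟩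
  · exact mul_le_mul_of_nonneg_right (by linarith) hu0
  · linarith
  · exact mul_le_mul_of_nonneg_right (by linarith) hu0
  · linarith

lemma marchPoly_det_eval (ρ : ℕ → ℝ) (i : ℕ) (u : ℝ) :
    (marchPoly ρ (1, 0) i).1.eval u * (marchPoly ρ (0, 1) i).2.eval u
      - (marchPoly ρ (0, 1) i).1.eval u * (marchPoly ρ (1, 0) i).2.eval u = 1 := by
  have h := march_det (fun j => algebraMap ℝ ℝ (ρ j)) u i
  rw [march_aeval_left, march_aeval_right] at h
  simpa only [Polynomial.coe_aeval_eq_eval] using h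

lemma march_complex (ρ : ℕ → ℝ) (lam : ℝ) (f : ℂ) (i : ℕ) :
    (march (fun j => algebraMap ℝ ℂ (ρ j)) (lam : ℂ) (1, f) i).1
      = ((marchPoly ρ (1, 0) i).1.eval lam : ℝ) + ((marchPoly ρ (0, 1) i).1.eval lam : ℝ) * f ∧
    (march (fun j => algebraMap ℝ ℂ (ρ j)) (lam : ℂ) (1, f) i).2
      = ((marchPoly ρ (1, 0) i).2.eval lam : ℝ) + ((marchPoly ρ (0, 1) i).2.eval lam : ℝ) * f := by
  have key : ∀ r : Polynomial ℝ, Polynomial.aeval (lam : ℂ) r = ((r.eval lam : ℝ) : ℂ) := by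
    intro r
    have := Polynomial.aeval_algebraMap_apply ℂ lam r
    rwa [Polynomial.coe_aeval_eq_eval] at this
  rw [(march_eq_add _ _ _ i).1, march_snd, march_aeval_left, march_aeval_right]
  simp only [key, mul_one, and_self]

/-- A root of the characteristic equation of the patch scheme near the symbol of the
homogenisation. -/
lemma exists_root {τ q : Polynomial ℝ} {δ c K lam₀ η y ε : ℝ} (hη : 0 ≤ η)
    (hslope : ∀ u v : ℝ, -δ ≤ u → u ≤ v → v ≤ δ → c * (v - u) ≤ τ.eval v - τ.eval u)
    (hq : ∀ u : ℝ, |u| ≤ δ → |q.eval u| ≤ K) (hlam : |lam₀| + η ≤ δ)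
    (hres : |τ.eval lam₀ - y| + |ε| * K ≤ c * η) :
    ∃ lam : ℝ, |lam - lam₀| ≤ η ∧ τ.eval lam + ε * q.eval lam = y := by
  have hl := abs_le.1 (show |lam₀| ≤ δ - η by linarith)
  have hcont : ContinuousOn (fun u => τ.eval u + ε * q.eval u) (Set.Icc (lam₀ - η) (lam₀ + η)) := by
    fun_prop
  have hab := abs_le.1 (show |τ.eval lam₀ - y| ≤ c * η - |ε| * K by linarith)
  have hb : ∀ u : ℝ, |u| ≤ δ → -(|ε| * K) ≤ ε * q.eval u ∧ ε * q.eval u ≤ |ε| * K := by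
    intro u hu
    rw [← abs_le, abs_mul]
    exact mul_le_mul_of_nonneg_left (hq u hu) (abs_nonneg ε)
  have h1 := hslope (lam₀ - η) lam₀ (by linarith) (by linarith) (by linarith)
  have h2 := hslope lam₀ (lam₀ + η) (by linarith) (by linarith) (by linarith)
  have h3 := hb (lam₀ - η) (abs_le.2 ⟨by linarith, by linarith⟩)
  have h4 := hb (lam₀ + η) (abs_le.2 ⟨by linarith, by linarith⟩)
  rw [sub_sub_cancel] at h1
  rw [add_sub_cancel_left] at h2
  -- At distance `η` on either side of `lam₀` the slope has moved τ by at least `c * η`, which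
  -- exceeds the residual and the perturbation together.
  obtain ⟨lam, hmem, hF⟩ := intermediate_value_Icc (by linarith) hcont
    (show y ∈ Set.Icc _ _ from ⟨by linarith, by linarith⟩)
  exact ⟨lam, abs_le.2 ⟨by linarith [hmem.1], by linarith [hmem.2]⟩, hF⟩

set_option maxHeartbeats 1000000 in
/-- The slow mode of the patch scheme, for a scaled wavenumber `x` on the lattice and `θ` on the
macroscale, and a coupling of symbol `a`. -/
lemma exists_mode [NeZero p] {κ : ZMod p → ℝ} (hκ : ∀ ℓ, 0 < κ ℓ) {g : PowerSeries ℝ}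
    (hg : IsHomogenisedSymbol κ g) {n : ℕ} (hn : 1 ≤ n) (hpn : p ∣ n) {M : ℕ} (hM : 1 ≤ M)
    {C₀ : ℝ} (hC₀ : 0 ≤ C₀) :
    ∃ C θ₀ : ℝ, 0 ≤ C ∧ 0 < θ₀ ∧ ∀ (x θ r : ℝ) (a : ℂ), 0 ≤ x → n * x ≤ θ → θ ≤ θ₀ →
      r * θ = n * x → SymbolBound M C₀ r θ a →
      ∃ (lam : ℝ) (y : ℤ → ℂ), lam ≤ 0 ∧
        |lam - truncatedSymbol g M x| ≤ C * (x ^ 2 * θ ^ (2 * M)) ∧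
        (∀ i ∈ Finset.Icc (1 : ℤ) n, ‖y i - 1‖ ≤ C * x) ∧
        y (n + 1) = a * y 1 ∧ y 0 = (starRingEnd ℂ) a * y n ∧
        ∀ i ∈ Finset.Icc (1 : ℤ) n, lam * y i
          = κ (i : ZMod p) * (y (i + 1) - y i) + κ ((i - 1 : ℤ) : ZMod p) * (y (i - 1) - y i) := by
  set ρ := resistance κ with hρ
  set S := ∑ j ∈ Finset.range n, ρ (j + 1) with hS
  have hSpos : 0 < S := sum_resistance_pos hκ hn
  obtain ⟨δ, c, hδ, hc, hslope⟩ := exists_slope_bound _ (marchTrace_coeff_one_pos hκ hn)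
  obtain ⟨K₁, hK₁, hres⟩ := hg.marchTrace_eval_truncatedSymbol hκ hpn M
  obtain ⟨K₂, hK₂, hmb⟩ := exists_marchPoly_bound ρ n
  obtain ⟨K₃, hK₃, htr⟩ := abs_truncatedSymbol_add_le g hM
  set k₂ := PowerSeries.coeff 2 g with hk₂
  have hk₂pos : 0 < k₂ := by
    rw [hk₂, hg.coeff_two hκ]
    exact div_pos (by exact_mod_cast NeZero.pos p)
      (Finset.sum_pos (fun ℓ _ => inv_pos.2 (hκ ℓ)) Finset.univ_nonempty)
  have hκ0 := hκ 0
  have hn1 : (1 : ℝ) ≤ n := by exact_mod_cast hn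
  set Q := K₂ + κ 0 * K₂ with hQ
  have hQ0 : 0 ≤ Q := by positivity
  -- Divided by the slope `c`, the three contributions are truncation of the symbol, error in Re a,
  -- and error in |a|².
  set E := (K₁ + 2 * (C₀ * n ^ 2) + C₀ * n ^ 2 * Q) / c with hE
  have hE0 : 0 ≤ E := by positivity
  set W := k₂ + K₃ + E with hW
  have hW0 : 0 ≤ W := by positivity
  set F := 2 / S * (C₀ * n + K₂ * W) with hF
  have hF0 : 0 ≤ F := by positivity
  -- The bounds by 1 and `δ` keep the root where the estimates hold, `k₂` forces `lam ≤ 0`, and `S /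
  -- 2` keeps the entry `B` away from 0.
  set T := min (min 1 δ) (min k₂ (S / 2)) with hT
  have hTpos : 0 < T := lt_min (lt_min one_pos hδ) (lt_min hk₂pos (half_pos hSpos))
  set Z := W + K₂ * W + 1 with hZ
  have hZpos : 0 < Z := by positivity
  refine ⟨E + (K₂ * W + K₂ * F), min 1 (T / Z), by positivity, lt_min one_pos (div_pos hTpos hZpos),
    fun x θ r a hx hxθ hθ hrθ hsym => ?_⟩
  have hxθ' : x ≤ θ := (le_mul_of_one_le_left hx hn1).trans hxθ
  have hθ0 : 0 ≤ θ := hx.trans hxθ'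
  have hθ1 : θ ≤ 1 := hθ.trans (min_le_left _ _)
  have hx1 : x ≤ 1 := hxθ'.trans hθ1
  have hZθ : Z * θ ≤ T := by
    have := (le_div_iff₀ hZpos).1 (hθ.trans (min_le_right _ _))
    linarith
  have hθsq : θ ^ 2 ≤ θ := pow_le_of_le_one hθ0 hθ1 two_ne_zero
  have hxsq : x ^ 2 ≤ θ ^ 2 := by gcongr
  have hθM : θ ^ (2 * M) ≤ θ ^ 2 := pow_le_pow_of_le_one hθ0 hθ1 (by omega)
  have hθM1 : θ ^ (2 * M) ≤ 1 := pow_le_one₀ hθ0 hθ1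
  have hWθ : W * θ ≤ T ∧ K₂ * (W * θ) ≤ T := by
    have : 0 ≤ W * θ := by positivity
    have : 0 ≤ K₂ * (W * θ) := by positivity
    have : Z * θ = W * θ + K₂ * (W * θ) + θ := by rw [hZ]; ring
    constructor <;> linarith
  have hT1 : T ≤ 1 := (min_le_left _ _).trans (min_le_left _ _)
  have hTk : T ≤ k₂ := (min_le_right _ _).trans (min_le_left _ _)
  have hTS : T ≤ S / 2 := (min_le_right _ _).trans (min_le_right _ _)
  set lam₀ := truncatedSymbol g M x with hlam₀
  set η := E * (x ^ 2 * θ ^ (2 * M)) with hη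
  have hη0 : 0 ≤ η := by positivity
  have hηx : η ≤ E * x ^ 2 := by
    rw [hη]
    exact mul_le_mul_of_nonneg_left (mul_le_of_le_one_right (sq_nonneg x) hθM1) hE0
  have ht := htr x hx hx1
  have hx4 : x ^ 4 ≤ x ^ 2 * θ ^ 2 := by
    calc x ^ 4 = x ^ 2 * x ^ 2 := by ring
      _ ≤ _ := by gcongr
  have hx4' : x ^ 4 ≤ x ^ 2 := pow_le_pow_of_le_one hx hx1 (by norm_num)
  have hlamW : |lam₀| + η ≤ W * x ^ 2 := by
    have h1 : |lam₀| ≤ K₃ * x ^ 4 + k₂ * x ^ 2 := by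
      have := abs_sub (lam₀ + k₂ * x ^ 2) (k₂ * x ^ 2)
      rw [add_sub_cancel_right, abs_of_nonneg (show 0 ≤ k₂ * x ^ 2 by positivity)] at this
      linarith
    have h2 : K₃ * x ^ 4 ≤ K₃ * x ^ 2 := by gcongr
    rw [hW]
    linarith
  have hWx : W * x ^ 2 ≤ W * θ := by
    have : x ^ 2 ≤ θ := hxsq.trans hθsq
    gcongr
  set ε := Complex.normSq a - 1 with hε
  have hsre := hsym.re
  have hsn := hsym.normSq
  have hs1 := hsym.sub_one
  rw [hrθ] at hsre hsn hs1
  obtain ⟨lam, hlam, hroot⟩ := exists_root (τ := marchTrace ρ n)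
    (q := (marchPoly ρ (0, 1) n).2 - Polynomial.C (κ 0) * (marchPoly ρ (0, 1) n).1)
    (δ := min 1 δ) (c := c) (K := Q) (lam₀ := lam₀) (η := η) (y := 2 * a.re) (ε := ε) hη0
    (fun u v hu huv hv => hslope u v (by linarith [min_le_right 1 δ]) huv
      (hv.trans (min_le_right _ _)))
    (by
      intro u hu
      obtain ⟨-, hb, -, hd⟩ := hmb n le_rfl u (hu.trans (min_le_left _ _))
      rw [Polynomial.eval_sub, Polynomial.eval_mul, Polynomial.eval_C]
      refine (abs_sub _ _).trans (add_le_add hd ?_)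
      rw [abs_mul, abs_of_pos hκ0]
      gcongr)
    (by
      refine (hlamW.trans (hWx.trans (hWθ.1.trans ?_)))
      exact min_le_left _ _)
    (by
      have h1 := hres x hx hx1 (hxθ.trans hθ1)
      have h2 : x ^ (2 * M + 2) ≤ x ^ 2 * θ ^ (2 * M) := by
        rw [pow_add, mul_comm]
        gcongr
      have h3 : |(marchTrace ρ n).eval lam₀ - 2 * a.re|
          ≤ K₁ * x ^ (2 * M + 2) + 2 * (C₀ * ((n * x) ^ 2 * θ ^ (2 * M))) := by
        refine (abs_sub_le _ (2 * Real.cos (n * x)) _).trans (add_le_add h1 ?_)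
        rw [← mul_sub, abs_mul, abs_sub_comm, abs_two]
        gcongr
      calc _ ≤ K₁ * (x ^ 2 * θ ^ (2 * M)) + 2 * (C₀ * ((n * x) ^ 2 * θ ^ (2 * M)))
            + C₀ * ((n * x) ^ 2 * θ ^ (2 * M)) * Q := by
              refine add_le_add (h3.trans (add_le_add (by gcongr) le_rfl)) (by gcongr)
        _ = (K₁ + 2 * (C₀ * n ^ 2) + C₀ * n ^ 2 * Q) * (x ^ 2 * θ ^ (2 * M)) := by ring
        _ = c * η := by rw [hη, hE]; field_simp)
  rw [Polynomial.eval_sub, Polynomial.eval_mul, Polynomial.eval_C, marchTrace,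
    Polynomial.eval_add] at hroot
  have hlamabs : |lam| ≤ W * x ^ 2 := by
    have := abs_add_le (lam - lam₀) lam₀
    rw [sub_add_cancel] at this
    linarith
  have hlam1 : |lam| ≤ 1 := hlamabs.trans (hWx.trans (hWθ.1.trans hT1))
  have hlamx : |lam| ≤ W * x := hlamabs.trans
    (mul_le_mul_of_nonneg_left (pow_le_of_le_one hx hx1 two_ne_zero) hW0)
  have hdet := marchPoly_det_eval ρ n lam
  obtain ⟨hA1, -, hBS, -⟩ := hmb n le_rfl lam hlam1
  set A := (marchPoly ρ (1, 0) n).1.eval lam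
  set B := (marchPoly ρ (0, 1) n).1.eval lam
  set C := (marchPoly ρ (1, 0) n).2.eval lam
  set D := (marchPoly ρ (0, 1) n).2.eval lam
  have hB : S / 2 ≤ B := by
    have h1 : K₂ * |lam| ≤ K₂ * (W * θ) := by gcongr; exact hlamabs.trans hWx
    have h2 := (abs_le.1 hBS).1
    linarith [hWθ.2]
  have hBpos : 0 < B := lt_of_lt_of_le (half_pos hSpos) hB
  have hB0 : (B : ℂ) ≠ 0 := Complex.ofReal_ne_zero.2 hBpos.ne'
  -- The initial flux forced by `y (n + 1) = a * y 1` with `y 1 = 1`.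
  set f : ℂ := (a - A) / B with hf
  have hBf : (B : ℂ) * f = a - A := by rw [hf]; field_simp
  have hfn : ‖f‖ ≤ F * x := by
    have h1 : ‖a - (A : ℂ)‖ ≤ (C₀ * n + K₂ * W) * x := by
      have h2 : ‖(A : ℂ) - 1‖ ≤ K₂ * |lam| := by
        rw [← Complex.ofReal_one, ← Complex.ofReal_sub, Complex.norm_real]
        exact hA1
      have h3 := norm_sub_le (a - 1) ((A : ℂ) - 1)
      rw [sub_sub_sub_cancel_right] at h3
      have h4 : K₂ * |lam| ≤ K₂ * (W * x) := by gcongr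
      linarith
    rw [hf, norm_div, Complex.norm_real, Real.norm_eq_abs, abs_of_pos hBpos, div_le_iff₀ hBpos]
    calc _ ≤ (C₀ * n + K₂ * W) * x := h1
      _ = F * x * (S / 2) := by rw [hF]; field_simp
      _ ≤ _ := by gcongr
  set b := (starRingEnd ℂ) a with hb
  have hab : a * b = (Complex.normSq a : ℂ) := Complex.mul_conj a
  have hab2 : a + b = ((2 * a.re : ℝ) : ℂ) := Complex.add_conj a
  have hrootC : a + b = A + D + (a * b - 1) * (D - κ 0 * B) := by
    rw [hab, hab2, ← hroot, hε]
    push_cast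
    ring
  have hdetC : (A : ℂ) * D - B * C = 1 := by exact_mod_cast hdet
  -- Multiplied by `B ≠ 0`, the left edge condition is the characteristic equation, by the
  -- determinant identity.
  obtain ⟨y, hy, hy0, hyode⟩ := exists_patch_field κ hκ hn hpn (lam : ℂ) a b f
    (by rw [← hρ, (march_complex ρ lam f n).1, hBf]; ring)
    (by
      rw [← hρ, (march_complex ρ lam f n).2]
      apply mul_left_cancel₀ hB0
      linear_combination (b * D - 1) * hBf - b * hdetC - hrootC)
  have hyn : ∀ i < n, ‖y (i + 1) - 1‖ ≤ (K₂ * W + K₂ * F) * x := by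
    intro i hi
    rw [hy, ← hρ, (march_complex ρ lam f i).1]
    obtain ⟨hAi, hBi, -, -⟩ := hmb i hi.le lam hlam1
    have h2 : ‖(((marchPoly ρ (1, 0) i).1.eval lam : ℝ) : ℂ) - 1‖ ≤ K₂ * |lam| := by
      rw [← Complex.ofReal_one, ← Complex.ofReal_sub, Complex.norm_real]
      exact hAi
    have h3 : ‖(((marchPoly ρ (0, 1) i).1.eval lam : ℝ) : ℂ) * f‖ ≤ K₂ * (F * x) := by
      rw [norm_mul, Complex.norm_real]
      gcongr
      exact hBi
    have h4 : K₂ * |lam| ≤ K₂ * (W * x) := by gcongr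
    rw [add_sub_right_comm]
    refine (norm_add_le _ _).trans ?_
    linarith
  refine ⟨lam, y, ?_, ?_, ?_, ?_, hy0, hyode⟩
  -- Here `lam ≤ -k₂ x² + (K₃ + E) x² θ²`, and the threshold on `θ` makes the second term at most
  -- `k₂ x²`.
  · have h1 := (abs_le.1 ht).2
    have h2 := (abs_le.1 hlam).2
    have h3 : η ≤ E * (x ^ 2 * θ ^ 2) := by rw [hη]; gcongr
    have h4 : K₃ * x ^ 4 ≤ K₃ * (x ^ 2 * θ ^ 2) := by gcongr
    have h5 : (K₃ + E) * θ ^ 2 ≤ k₂ := by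
      have : (K₃ + E) * θ ^ 2 ≤ W * θ := by
        gcongr
        rw [hW]
        linarith
      linarith [hWθ.1]
    have h6 : x ^ 2 * ((K₃ + E) * θ ^ 2) ≤ x ^ 2 * k₂ := by gcongr
    linarith
  · refine hlam.trans ?_
    exact mul_le_mul_of_nonneg_right (le_add_of_nonneg_right (by positivity)) (by positivity)
  · intro i hi
    rw [Finset.mem_Icc] at hi
    obtain ⟨k, rfl⟩ : ∃ k : ℕ, i = k + 1 := ⟨(i - 1).toNat, by omega⟩
    exact (hyn k (by omega)).trans (mul_le_mul_of_nonneg_right (le_add_of_nonneg_left hE0) hx)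
  · have h1 := hy 0
    rw [Nat.cast_zero, zero_add, march_zero] at h1
    rw [h1, hy, ← hρ, (march_complex ρ lam f n).1, hBf]
    ring

/-! ### Consistency -/

lemma wave_ofReal_mul (θ r : ℝ) (z : ℂ) (x : ℝ) : wave θ ((r : ℂ) * z) x = r * wave θ z x := by
  rw [wave, wave, mul_assoc, Complex.re_ofReal_mul]

lemma wave_add_left (θ : ℝ) (z w : ℂ) (x : ℝ) : wave θ (z + w) x = wave θ z x + wave θ w x := by
  rw [wave, wave, wave, add_mul, Complex.add_re]

lemma wave_sub_left (θ : ℝ) (z w : ℂ) (x : ℝ) : wave θ (z - w) x = wave θ z x - wave θ w x := by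
  rw [wave, wave, wave, sub_mul, Complex.sub_re]

lemma wave_sum (θ : ℝ) (s : Finset ℤ) (f : ℤ → ℂ) (x : ℝ) :
    wave θ (∑ i ∈ s, f i) x = ∑ i ∈ s, wave θ (f i) x := by
  simp only [wave, Finset.sum_mul, Complex.re_sum]

lemma abs_wave_le (θ : ℝ) (z : ℂ) (x : ℝ) : |wave θ z x| ≤ ‖z‖ := by
  refine (Complex.abs_re_le_norm _).trans (le_of_eq ?_)
  rw [norm_mul, mul_comm Complex.I, Complex.norm_exp_ofReal_mul_I, mul_one]

lemma hasDerivAt_wave (k : ℝ) (z : ℂ) (x : ℝ) :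
    HasDerivAt (wave k z) (wave k (Complex.I * k * z) x) x := by
  have h : HasDerivAt (fun x => z.re * Real.cos (k * x) - z.im * Real.sin (k * x))
      (z.re * (-Real.sin (k * x) * (k * 1)) - z.im * (Real.cos (k * x) * (k * 1))) x :=
    ((((hasDerivAt_id x).const_mul k).cos).const_mul _).sub
      ((((hasDerivAt_id x).const_mul k).sin).const_mul _)
  rw [funext fun x => wave_eq k z x, wave_eq]
  refine h.congr_deriv ?_
  simp only [Complex.mul_re, Complex.mul_im, Complex.I_re, Complex.I_im, Complex.ofReal_re,
    Complex.ofReal_im]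
  ring

lemma iteratedDeriv_sum_wave (s : Finset ℕ) (e k : ℕ → ℝ) (z : ℕ → ℂ) (m : ℕ) :
    iteratedDeriv m (fun x => ∑ j ∈ s, e j * wave (k j) (z j) x)
      = fun x => ∑ j ∈ s, e j * wave (k j) ((Complex.I * k j) ^ m * z j) x := by
  induction m with
  | zero => simp
  | succ m ih =>
    rw [iteratedDeriv_succ, ih]
    funext x
    refine (HasDerivAt.fun_sum fun j _ => (hasDerivAt_wave _ _ _).const_mul _).deriv.trans ?_
    exact Finset.sum_congr rfl fun j _ => by
      rw [pow_succ' (Complex.I * (k j : ℂ)), mul_assoc (Complex.I * (k j : ℂ))]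

lemma homogenisedRHS_sum_wave (g : PowerSeries ℝ) {d : ℝ} (hd : d ≠ 0) (M : ℕ) (s : Finset ℕ)
    (e k : ℕ → ℝ) (z : ℕ → ℂ) (x : ℝ) :
    homogenisedRHS g d M (fun x => ∑ j ∈ s, e j * wave (k j) (z j) x) x
      = ∑ j ∈ s, truncatedSymbol g M (k j * d) / d ^ 2 * (e j * wave (k j) (z j) x) := by
  simp only [homogenisedRHS, iteratedDeriv_sum_wave, Finset.mul_sum]
  rw [Finset.sum_comm]
  refine Finset.sum_congr rfl fun j _ => ?_
  rw [truncatedSymbol, Finset.sum_div, Finset.sum_mul]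
  refine Finset.sum_congr rfl fun m hm => ?_
  have hI : (Complex.I * k j) ^ (2 * m) = (((-1) ^ m * k j ^ (2 * m) : ℝ) : ℂ) := by
    rw [mul_pow, pow_mul, Complex.I_sq]
    push_cast
    rfl
  have hdm : d ^ (2 * m) = d ^ (2 * m - 2) * d ^ 2 := by
    rw [← pow_add, Nat.sub_add_cancel]
    have := (Finset.mem_Icc.1 hm).1
    omega
  rw [hI, wave_ofReal_mul, mul_pow, hdm]
  field_simp

/-- A coupling whose symbols are accurate to order `2M`, uniformly in the ratio `r ≤ 1`. -/
def HasAccurateSymbols (c : Coupling) (M : ℕ) : Prop :=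
  ∃ C₀ : ℝ, 0 ≤ C₀ ∧ ∀ (N j : ℕ) (r : ℝ), 2 * j < N → 0 < r → r ≤ 1 → 2 * Real.pi * j / N ≤ 1 →
    ∃ a : ℂ, IsSymbol c N r (2 * Real.pi * j / N) a ∧
      IsSymbol c N (-r) (2 * Real.pi * j / N) ((starRingEnd ℂ) a) ∧
      SymbolBound M C₀ r (2 * Real.pi * j / N) a

lemma hasAccurateSymbols_spectral (M : ℕ) : HasAccurateSymbols .spectral M := by
  refine ⟨1, zero_le_one, fun N j r hj hr _ _ => ⟨_, isSymbol_spectral N j hj r, ?_,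
    symbolBound_spectral M hr.le (by positivity)⟩⟩
  convert isSymbol_spectral N j hj (-r) using 1
  rw [← Complex.exp_conj, map_mul, Complex.conj_I, Complex.conj_ofReal]
  congr 1
  push_cast
  ring

lemma hasAccurateSymbols_lagrangian {M P : ℕ} (hMP : M ≤ P) :
    HasAccurateSymbols (.lagrangian P) M := by
  obtain ⟨C, hC, h⟩ := symbolBound_lagrangian P
  refine ⟨C, hC, fun N j r hj hr hr1 hθ => ⟨_, isSymbol_lagrangian P N r _, ?_,
    h M hMP r _ hr hr1 (by positivity) hθ⟩⟩
  convert isSymbol_lagrangian P N (-r) (2 * Real.pi * j / N) using 1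
  apply Complex.ext <;> simp [lagrangianRe_neg, lagrangianIm_neg]

/-- A mode of the patch scheme, of wavenumber `θ` on the macroscale and `x` on the lattice,
normalised to have the macroscale value of the wave it approximates. -/
lemma exists_normalised_mode {n : ℕ} (hn : 1 ≤ n) {ω : ℤ → ℝ}
    (hω : ∑ i ∈ Finset.Icc (1 : ℤ) n, ω i = 1)
    {C x θ : ℝ} (hC : 0 ≤ C) (hx : 0 ≤ x) (hxθ : n * x ≤ θ)
    (hθ : (∑ i ∈ Finset.Icc (1 : ℤ) n, |ω i|) * C * θ ≤ 1 / 2) {y : ℤ → ℂ}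
    (hy : ∀ i ∈ Finset.Icc (1 : ℤ) n, ‖y i - 1‖ ≤ C * x) :
    ∃ q : ℂ,
      ∑ i ∈ Finset.Icc (1 : ℤ) n, (ω i : ℂ) * (q * y i)
        = Complex.exp (Complex.I * (x * (((n : ℝ) + 1) / 2) : ℝ)) ∧
      ∀ i ∈ Finset.Icc (1 : ℤ) n, ‖q * y i - Complex.exp (Complex.I * (x * (i : ℝ) : ℝ))‖
        ≤ (2 * (C + 1 + (∑ i ∈ Finset.Icc (1 : ℤ) n, |ω i|) * C) + 1) * θ := by
  set Ω := ∑ i ∈ Finset.Icc (1 : ℤ) n, |ω i| with hΩ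
  have hΩ0 : 0 ≤ Ω := Finset.sum_nonneg fun _ _ => abs_nonneg _
  have hn1 : (1 : ℝ) ≤ n := by exact_mod_cast hn
  have hxθ' : x ≤ θ := (le_mul_of_one_le_left hx hn1).trans hxθ
  -- The macroscale value of the raw mode. The weights may have any sign, so its distance to 1 is
  -- controlled by `Ω`; for small `θ` it is nonzero and can be divided out.
  set s := ∑ i ∈ Finset.Icc (1 : ℤ) n, (ω i : ℂ) * y i with hs
  have hs1 : ‖s - 1‖ ≤ Ω * C * θ := by
    have e : s - 1 = ∑ i ∈ Finset.Icc (1 : ℤ) n, (ω i : ℂ) * (y i - 1) := by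
      have : (∑ i ∈ Finset.Icc (1 : ℤ) n, (ω i : ℂ)) = 1 := by exact_mod_cast hω
      simp only [mul_sub, mul_one, Finset.sum_sub_distrib, this, hs]
    rw [e, hΩ, mul_assoc, Finset.sum_mul]
    refine (norm_sum_le _ _).trans (Finset.sum_le_sum fun i hi => ?_)
    rw [norm_mul, Complex.norm_real, Real.norm_eq_abs]
    refine mul_le_mul_of_nonneg_left ((hy i hi).trans ?_) (abs_nonneg _)
    gcongr
  have hsn : 1 / 2 ≤ ‖s‖ := by
    have := norm_sub_norm_le (1 : ℂ) s
    rw [norm_one, norm_sub_rev] at this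
    linarith
  have hs0 : s ≠ 0 := by
    rw [← norm_pos_iff]
    linarith
  set e := Complex.exp (Complex.I * (x * (((n : ℝ) + 1) / 2) : ℝ)) with he
  refine ⟨e / s, ?_, fun i hi => ?_⟩
  · rw [Finset.sum_congr rfl fun i _ => mul_left_comm _ (e / s) _, ← Finset.mul_sum, ← hs,
      div_mul_cancel₀ _ hs0]
  · have hi' := Finset.mem_Icc.1 hi
    have hi1 : (1 : ℝ) ≤ i := by exact_mod_cast hi'.1
    have hin : (i : ℝ) ≤ n := by exact_mod_cast hi'.2
    have hyi := hy i hi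
    have h1 : ‖e - 1‖ ≤ θ := by
      refine (norm_exp_I_sub_one_le _).trans ?_
      rw [abs_of_nonneg (by positivity)]
      refine le_trans ?_ hxθ
      rw [mul_comm]
      exact mul_le_mul_of_nonneg_right (by linarith) hx
    have h2 : ‖Complex.exp (Complex.I * (x * (i : ℝ) : ℝ)) - 1‖ ≤ θ := by
      refine (norm_exp_I_sub_one_le _).trans ?_
      rw [abs_of_nonneg (by positivity)]
      refine le_trans ?_ hxθ
      rw [mul_comm]
      exact mul_le_mul_of_nonneg_right hin hx
    have hen : ‖e‖ = 1 := by rw [he, mul_comm, Complex.norm_exp_ofReal_mul_I]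
    have h3 : ‖e / s * y i - 1‖ ≤ 2 * (C + 1 + Ω * C) * θ := by
      rw [show e / s * y i - 1 = (e * (y i - 1) + (e - 1) - (s - 1)) / s by field_simp; ring,
        norm_div, div_le_iff₀ (by linarith)]
      have h4 : ‖e * (y i - 1) + (e - 1) - (s - 1)‖ ≤ (C + 1 + Ω * C) * θ := by
        refine (norm_sub_le _ _).trans ((add_le_add (norm_add_le _ _) le_rfl).trans ?_)
        rw [norm_mul, hen, one_mul]
        have : C * x ≤ C * θ := by gcongr
        linarith
      refine h4.trans ?_
      have h5 : 0 ≤ (C + 1 + Ω * C) * θ := by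
        have : 0 ≤ θ := hx.trans hxθ'
        positivity
      calc (C + 1 + Ω * C) * θ = 2 * (C + 1 + Ω * C) * θ * (1 / 2) := by ring
        _ ≤ _ := by
          apply mul_le_mul_of_nonneg_left hsn
          linarith
    have h6 := norm_sub_le (e / s * y i - 1) (Complex.exp (Complex.I * (x * (i : ℝ) : ℝ)) - 1)
    rw [sub_sub_sub_cancel_right] at h6
    linarith

/-- A wave in space is a macroscale wave of wavenumber `k H` in the patch index, with a phase `k d
i` inside the patch. -/
lemma wave_location {L : ℝ} (N : ℕ) (d k : ℝ) (z : ℂ) (I : ℤ) (i : ℝ) :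
    wave k z (location L N d I i)
      = wave (k * spacing L N) (z * Complex.exp (Complex.I * (k * d * i : ℝ))) I := by
  rw [location, wave_add, wave, wave]
  congr 2
  · rw [show k * (i * d) = k * d * i by ring]
  · congr 1
    rw [show k * (I * spacing L N) = k * spacing L N * I by ring]

lemma wave_add_period (N j : ℕ) (hN : N ≠ 0) (z : ℂ) (I : ℤ) :
    wave (2 * Real.pi * j / N) z ((I + N : ℤ) : ℝ) = wave (2 * Real.pi * j / N) z I := by
  have hN0 : (N : ℝ) ≠ 0 := by exact_mod_cast hN
  rw [wave_eq, wave_eq, Int.cast_add, Int.cast_natCast,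
    show 2 * Real.pi * j / N * ((I : ℝ) + N) = 2 * Real.pi * j / N * I + j * (2 * Real.pi) by
      field_simp, Real.cos_add_nat_mul_two_pi, Real.sin_add_nat_mul_two_pi]

lemma trigField_eq_sum_wave (L : ℝ) (B : ℕ) (a₀ b₀ e : ℕ → ℝ) (x : ℝ) :
    trigField L B (fun j => a₀ j * e j) (fun j => b₀ j * e j) x
      = ∑ j ∈ Finset.range (B + 1), e j * wave (2 * Real.pi * j / L) ⟨a₀ j, -b₀ j⟩ x := by
  refine Finset.sum_congr rfl fun j _ => ?_
  rw [wave_eq, show 2 * Real.pi * j / L * x = 2 * Real.pi * j * x / L by ring]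
  ring

/-- A superposition of modes solves the patch scheme. -/
lemma isPatchSolution_of_modes {p : ℕ} (c : Coupling) {L : ℝ} {N n : ℕ} (hN : N ≠ 0) {d : ℝ}
    (hd : d ≠ 0) (κ : ZMod p → ℝ) (B : ℕ) (lam : ℕ → ℝ) (a : ℕ → ℂ) (ψ : ℕ → ℤ → ℂ) (z : ℕ → ℂ)
    (ha : ∀ j ≤ B, IsSymbol c N (ratio L N n d) (2 * Real.pi * j / N) (a j) ∧
      IsSymbol c N (-ratio L N n d) (2 * Real.pi * j / N) ((starRingEnd ℂ) (a j)))
    (hψ : ∀ j ≤ B, ψ j (n + 1) = a j * ψ j 1 ∧ ψ j 0 = (starRingEnd ℂ) (a j) * ψ j n ∧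
      ∀ i ∈ Finset.Icc (1 : ℤ) n, lam j * ψ j i = κ (i : ZMod p) * (ψ j (i + 1) - ψ j i)
        + κ ((i - 1 : ℤ) : ZMod p) * (ψ j (i - 1) - ψ j i)) :
    IsPatchSolution c L N n d κ fun t I i => ∑ j ∈ Finset.range (B + 1),
      wave (2 * Real.pi * j / N) ((Real.exp (lam j / d ^ 2 * t) : ℝ) * (z j * ψ j i)) I := by
  have hle : ∀ j ∈ Finset.range (B + 1), j ≤ B := fun j hj =>
    Nat.lt_succ_iff.1 (Finset.mem_range.1 hj)
  refine ⟨fun t I i => ?_, fun t I => ?_, fun t I => ?_, fun t I i hi => ?_⟩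
  · exact Finset.sum_congr rfl fun j _ => wave_add_period N j hN _ I
  · rw [shift_sum]
    refine Finset.sum_congr rfl fun j hj => ?_
    rw [(ha j (hle j hj)).1, (hψ j (hle j hj)).1]
    congr 1
    ring
  · rw [shift_sum]
    refine Finset.sum_congr rfl fun j hj => ?_
    rw [(ha j (hle j hj)).2, (hψ j (hle j hj)).2.1]
    congr 1
    ring
  · simp only [wave_ofReal_mul]
    have hD : ∀ j ∈ Finset.range (B + 1), HasDerivAt
        (fun s => Real.exp (lam j / d ^ 2 * s) * wave (2 * Real.pi * j / N) (z j * ψ j i) I)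
        (Real.exp (lam j / d ^ 2 * t) * (lam j / d ^ 2 * 1)
          * wave (2 * Real.pi * j / N) (z j * ψ j i) I) t := fun j _ =>
      (((hasDerivAt_id t).const_mul _).exp).mul_const _
    refine (HasDerivAt.fun_sum hD).congr_deriv ?_
    rw [← Finset.sum_sub_distrib, ← Finset.sum_sub_distrib, Finset.mul_sum, Finset.mul_sum,
      ← Finset.sum_add_distrib, Finset.sum_div]
    refine Finset.sum_congr rfl fun j hj => ?_
    have h := congrArg (fun w => wave (2 * Real.pi * j / N) (z j * w) I)
      ((hψ j (hle j hj)).2.2 i hi)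
    simp only [mul_add, mul_left_comm (z j), wave_add_left, wave_ofReal_mul, mul_sub (z j),
      wave_sub_left] at h
    rw [eq_div_iff (pow_ne_zero 2 hd)]
    have hd2 : lam j / d ^ 2 * d ^ 2 = lam j := div_mul_cancel₀ _ (pow_ne_zero 2 hd)
    linear_combination Real.exp (lam j / d ^ 2 * t) * h + Real.exp (lam j / d ^ 2 * t)
      * wave (2 * Real.pi * j / N) (z j * ψ j i) I * hd2

set_option maxHeartbeats 1000000 in
/-- Accurate symbols make the patch scheme consistent with the homogenisation. -/
lemma consistentToOrder_of_hasAccurateSymbols {p : ℕ} [NeZero p] {κ : ZMod p → ℝ}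
    (hκ : ∀ ℓ, 0 < κ ℓ) {g : PowerSeries ℝ} (hg : IsHomogenisedSymbol κ g) {n : ℕ} (hn : 1 ≤ n)
    (hpn : p ∣ n) {L : ℝ} (hL : 0 < L) {M : ℕ} (hM : 1 ≤ M) {c : Coupling}
    (hc : HasAccurateSymbols c M) : ConsistentToOrder c L n κ g M := by
  intro ω hω B a₀ b₀
  obtain ⟨C₀, hC₀, hsym⟩ := hc
  obtain ⟨C, θ₀, hC, hθ₀, hmode⟩ := exists_mode hκ hg hn hpn hM hC₀
  set Ω := ∑ i ∈ Finset.Icc (1 : ℤ) n, |ω i| with hΩ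
  have hΩ0 : 0 ≤ Ω := Finset.sum_nonneg fun _ _ => abs_nonneg _
  have hn1 : (1 : ℝ) ≤ n := by exact_mod_cast hn
  set θ₁ := min (min 1 θ₀) (1 / (2 * (Ω * C + 1))) with hθ₁
  have hθ₁pos : 0 < θ₁ := lt_min (lt_min one_pos hθ₀) (by positivity)
  set k : ℕ → ℝ := fun j => 2 * Real.pi * j / L with hk
  have hk0 : ∀ j, 0 ≤ k j := fun j => by positivity
  set z : ℕ → ℂ := fun j => ⟨a₀ j, -b₀ j⟩ with hz
  set D := 2 * (C + 1 + Ω * C) + 1 with hD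
  have hD0 : 0 ≤ D := by positivity
  set C₁ := ∑ j ∈ Finset.range (B + 1), ‖z j‖ * (D * k j) with hC₁
  set C₂ := ∑ j ∈ Finset.range (B + 1), C * (k j ^ 2 * k j ^ (2 * M)) * ‖z j‖ with hC₂
  have hC₁0 : 0 ≤ C₁ := Finset.sum_nonneg fun j _ => by have := hk0 j; positivity
  have hC₂0 : 0 ≤ C₂ := Finset.sum_nonneg fun j _ => by have := hk0 j; positivity
  -- The first bound resolves all wavenumbers up to `B` on `N` patches; the second makes them at
  -- most `θ₁`.
  refine ⟨C₁ + C₂, max (2 * B + 1) ⌈2 * Real.pi * B / θ₁⌉₊, fun N hN d hd hnd => ?_⟩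
  have hNB : 2 * B + 1 ≤ N := (le_max_left _ _).trans hN
  have hN0 : N ≠ 0 := by omega
  have hNpos : (0 : ℝ) < N := by exact_mod_cast Nat.pos_of_ne_zero hN0
  set H := spacing L N with hH
  have hHdef : H = L / N := rfl
  have hHpos : 0 < H := div_pos hL hNpos
  set r := ratio L N n d with hr
  have hrdef : r = n * d / H := rfl
  have hrpos : 0 < r := div_pos (by positivity) hHpos
  have hr1 : r ≤ 1 := (div_le_one hHpos).2 hnd
  have hθk : ∀ j : ℕ, 2 * Real.pi * j / N = k j * H := by
    intro j
    rw [hHdef, hk]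
    field_simp
  have hθle : ∀ j ≤ B, 2 * Real.pi * j / N ≤ θ₁ := by
    intro j hj
    have h1 : 2 * Real.pi * B / θ₁ ≤ N :=
      (Nat.le_ceil _).trans (by exact_mod_cast (le_max_right _ _).trans hN)
    rw [div_le_iff₀ hθ₁pos] at h1
    rw [div_le_iff₀ hNpos, mul_comm θ₁]
    refine le_trans ?_ h1
    have : (j : ℝ) ≤ B := by exact_mod_cast hj
    gcongr
  have hnx : ∀ j, n * (k j * d) ≤ 2 * Real.pi * j / N := by
    intro j
    rw [hθk, mul_left_comm]
    exact mul_le_mul_of_nonneg_left hnd (hk0 j)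
  have hex : ∀ j, ∃ (lam : ℝ) (a : ℂ) (ψ : ℤ → ℂ), j ≤ B →
      (IsSymbol c N r (2 * Real.pi * j / N) a ∧
        IsSymbol c N (-r) (2 * Real.pi * j / N) ((starRingEnd ℂ) a)) ∧
      (ψ (n + 1) = a * ψ 1 ∧ ψ 0 = (starRingEnd ℂ) a * ψ n ∧
        ∀ i ∈ Finset.Icc (1 : ℤ) n, lam * ψ i = κ (i : ZMod p) * (ψ (i + 1) - ψ i)
          + κ ((i - 1 : ℤ) : ZMod p) * (ψ (i - 1) - ψ i)) ∧
      lam ≤ 0 ∧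
      |lam - truncatedSymbol g M (k j * d)|
        ≤ C * ((k j * d) ^ 2 * (2 * Real.pi * j / N) ^ (2 * M)) ∧
      ∑ i ∈ Finset.Icc (1 : ℤ) n, (ω i : ℂ) * ψ i
        = Complex.exp (Complex.I * (k j * d * (((n : ℝ) + 1) / 2) : ℝ)) ∧
      ∀ i ∈ Finset.Icc (1 : ℤ) n, ‖ψ i - Complex.exp (Complex.I * (k j * d * (i : ℝ) : ℝ))‖
        ≤ D * (2 * Real.pi * j / N) := by
    intro j
    by_cases hj : j ≤ B
    · have hθj := hθle j hj
      have hkd : 0 ≤ k j * d := mul_nonneg (hk0 j) hd.le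
      obtain ⟨a, ha, ha', hb⟩ := hsym N j r (by omega) hrpos hr1
        (hθj.trans ((min_le_left _ _).trans (min_le_left _ _)))
      obtain ⟨lam, y, hlam, hlam', hy, hy1, hy0, hode⟩ := hmode (k j * d) (2 * Real.pi * j / N) r a
        hkd (hnx j) (hθj.trans ((min_le_left _ _).trans (min_le_right _ _)))
        (by rw [hθk, hrdef]; field_simp) hb
      obtain ⟨q, hq, hq'⟩ := exists_normalised_mode hn hω hC hkd (hnx j) (by
        have h1 := hθj.trans (min_le_right _ _)
        rw [le_div_iff₀ (by positivity)] at h1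
        have : (0 : ℝ) ≤ 2 * Real.pi * j / N := by positivity
        rw [← hΩ]
        linarith) hy
      refine ⟨lam, a, fun i => q * y i, fun _ => ⟨⟨ha, ha'⟩, ⟨?_, ?_, fun i hi => ?_⟩, hlam, hlam',
        hq, hq'⟩⟩
      · linear_combination q * hy1
      · linear_combination q * hy0
      · linear_combination q * hode i hi
    -- Default beyond the band, so that modes can be chosen for every `j`.
    · exact ⟨0, 0, 0, fun h => absurd h hj⟩
  choose lam a ψ hm using hex
  have hle : ∀ j ∈ Finset.range (B + 1), j ≤ B := fun j hj =>
    Nat.lt_succ_iff.1 (Finset.mem_range.1 hj)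
  -- The same real factors drive the microscale modes and the coefficients of `V`; as the rates are
  -- nonpositive they stay at most 1, whence uniformity in time.
  set e : ℝ → ℕ → ℝ := fun t j => Real.exp (lam j / d ^ 2 * t) with he
  have he1 : ∀ t, 0 ≤ t → ∀ j ≤ B, e t j ≤ 1 := by
    intro t ht j hj
    rw [he, Real.exp_le_one_iff]
    exact mul_nonpos_of_nonpos_of_nonneg
      (div_nonpos_of_nonpos_of_nonneg (hm j hj).2.2.1 (by positivity)) ht
  have he0 : ∀ t j, 0 ≤ e t j := fun t j => (Real.exp_pos _).le
  have hV : ∀ t x, trigField L B (fun j => a₀ j * e t j) (fun j => b₀ j * e t j) x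
      = ∑ j ∈ Finset.range (B + 1), e t j * wave (k j) (z j) x := fun t x =>
    trigField_eq_sum_wave L B a₀ b₀ (e t) x
  refine ⟨_, fun t j => a₀ j * e t j, fun t j => b₀ j * e t j,
    isPatchSolution_of_modes c hN0 hd.ne' κ B lam a ψ z (fun j hj => (hm j hj).1)
      (fun j hj => (hm j hj).2.1), ?_, ?_, fun t ht => ⟨fun I => ?_, fun I i hi => ?_, fun x => ?_⟩⟩
  · funext j; simp [he]
  · funext j; simp [he]
  · rw [hV]
    simp only [wave_location, Finset.mul_sum]
    rw [Finset.sum_comm]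
    refine Finset.sum_congr rfl fun j hj => ?_
    rw [← hH, ← hθk, ← (hm j (hle j hj)).2.2.2.2.1, Finset.mul_sum, wave_sum, Finset.mul_sum]
    refine Finset.sum_congr rfl fun i _ => ?_
    rw [wave_ofReal_mul, mul_left_comm (z j), wave_ofReal_mul]
    ring
  · rw [hV, ← Finset.sum_sub_distrib]
    simp only [wave_location]
    have : C₁ * H ≤ (C₁ + C₂) * H := mul_le_mul_of_nonneg_right (by linarith) hHpos.le
    refine le_trans ?_ this
    rw [hC₁, Finset.sum_mul]
    refine (Finset.abs_sum_le_sum_abs _ _).trans (Finset.sum_le_sum fun j hj => ?_)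
    rw [← hH, ← hθk, wave_ofReal_mul, ← mul_sub, ← wave_sub_left, ← mul_sub, abs_mul,
      abs_of_nonneg (he0 t j)]
    have h1 := (hm j (hle j hj)).2.2.2.2.2 i hi
    rw [hθk] at h1
    calc e t j * |wave (2 * Real.pi * j / N) (z j * (ψ j i
          - Complex.exp (Complex.I * (k j * d * (i : ℝ) : ℝ)))) I|
        ≤ 1 * ‖z j * (ψ j i - Complex.exp (Complex.I * (k j * d * (i : ℝ) : ℝ)))‖ :=
          mul_le_mul (he1 t ht j (hle j hj)) (abs_wave_le _ _ _) (abs_nonneg _) zero_le_one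
      _ ≤ ‖z j‖ * (D * (k j * H)) := by
          rw [one_mul, norm_mul]
          exact mul_le_mul_of_nonneg_left h1 (norm_nonneg _)
      _ = _ := by ring
  · have hderiv : HasDerivAt (fun s => trigField L B (fun j => a₀ j * e s j)
        (fun j => b₀ j * e s j) x)
        (∑ j ∈ Finset.range (B + 1), lam j / d ^ 2 * (e t j * wave (k j) (z j) x)) t := by
      simp only [hV]
      have h1 : ∀ j ∈ Finset.range (B + 1), HasDerivAt (fun s => e s j * wave (k j) (z j) x)
          (Real.exp (lam j / d ^ 2 * t) * (lam j / d ^ 2 * 1) * wave (k j) (z j) x) t :=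
        fun j _ => (((hasDerivAt_id t).const_mul _).exp).mul_const _
      refine (HasDerivAt.fun_sum h1).congr_deriv (Finset.sum_congr rfl fun j _ => ?_)
      simp only [he]
      ring
    refine ⟨hderiv.differentiableAt, ?_⟩
    rw [hderiv.deriv, show trigField L B (fun j => a₀ j * e t j) (fun j => b₀ j * e t j)
      = fun x => ∑ j ∈ Finset.range (B + 1), e t j * wave (k j) (z j) x from funext (hV t),
      homogenisedRHS_sum_wave g hd.ne', ← Finset.sum_sub_distrib]
    have : C₂ * H ^ (2 * M) ≤ (C₁ + C₂) * H ^ (2 * M) :=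
      mul_le_mul_of_nonneg_right (by linarith) (by positivity)
    refine le_trans ?_ this
    rw [hC₂, Finset.sum_mul]
    refine (Finset.abs_sum_le_sum_abs _ _).trans (Finset.sum_le_sum fun j hj => ?_)
    have h1 := (hm j (hle j hj)).2.2.2.1
    rw [hθk] at h1
    rw [← sub_mul, ← sub_div, abs_mul, abs_div, abs_of_pos (show 0 < d ^ 2 by positivity), abs_mul,
      abs_of_nonneg (he0 t j)]
    -- The factor `(k j * d) ^ 2` in the error of the rate absorbs the division by `d ^ 2`, so the
    -- bound is uniform in `d`.
    have h2 : |lam j - truncatedSymbol g M (k j * d)| / d ^ 2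
        ≤ C * (k j ^ 2 * k j ^ (2 * M)) * H ^ (2 * M) := by
      rw [div_le_iff₀ (by positivity)]
      refine h1.trans (le_of_eq ?_)
      rw [mul_pow, mul_pow]
      ring
    have h3 : e t j * |wave (k j) (z j) x| ≤ 1 * ‖z j‖ :=
      mul_le_mul (he1 t ht j (hle j hj)) (abs_wave_le _ _ _) (abs_nonneg _) zero_le_one
    have hkj := hk0 j
    calc _ ≤ C * (k j ^ 2 * k j ^ (2 * M)) * H ^ (2 * M) * (1 * ‖z j‖) :=
          mul_le_mul h2 h3 (mul_nonneg (he0 t j) (abs_nonneg _)) (by positivity)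
      _ = _ := by ring

end PatchScheme

/-! ### The main theorem -/

theorem mainTheorem5 (p : ℕ) [NeZero p] (κ : ZMod p → ℝ) (hκ : ∀ ℓ, 0 < κ ℓ)
    (n : ℕ) (hn : 1 ≤ n) (hpn : p ∣ n) (L : ℝ) (hL : 0 < L) :
    (∀ (c : PatchScheme.Coupling) (N : ℕ) (d : ℝ), 1 ≤ N → 0 < d →
      n * d ≤ PatchScheme.spacing L N → ∀ v : ℝ → ℤ → ℤ → ZMod p → ℝ,
        (PatchScheme.IsEnsemblePatchSolution c L N n d κ v ↔
          ∀ φ : ZMod p, PatchScheme.IsPatchSolution c L N n d (fun ℓ => κ (ℓ + φ))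
            (fun t I i => v t I i ((i : ZMod p) + φ)))) ∧
    ∃ g : PowerSeries ℝ,
      PatchScheme.IsHomogenisedSymbol κ g ∧
      (∀ g₁ : PowerSeries ℝ, PatchScheme.IsHomogenisedSymbol κ g₁ → g₁ = g) ∧
      (∀ m : ℕ, PowerSeries.coeff (2 * m + 1) g = 0) ∧
      PowerSeries.coeff 2 g = (p : ℝ) / ∑ ℓ, (κ ℓ)⁻¹ ∧
      (∀ M : ℕ, 1 ≤ M →
        PatchScheme.ConsistentToOrder PatchScheme.Coupling.spectral L n κ g M) ∧
      (∀ P M : ℕ, 1 ≤ M → M ≤ P →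
        PatchScheme.ConsistentToOrder (PatchScheme.Coupling.lagrangian P) L n κ g M) := by
  refine ⟨fun c N d _ _ _ v => PatchScheme.isEnsemblePatchSolution_iff κ n hpn L c N d v, ?_⟩
  obtain ⟨g, hg⟩ := PatchScheme.exists_isHomogenisedSymbol hκ
  exact ⟨g, hg, fun g₁ hg₁ => hg.unique hκ hg₁, hg.coeff_odd hκ, hg.coeff_two hκ,
    fun M hM => PatchScheme.consistentToOrder_of_hasAccurateSymbols hκ hg hn hpn hL hM
      (PatchScheme.hasAccurateSymbols_spectral M),
    fun P M hM hMP => PatchScheme.consistentToOrder_of_hasAccurateSymbols hκ hg hn hpn hL hM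
      (PatchScheme.hasAccurateSymbols_lagrangian hMP)⟩
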